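/- Conventions. $\mathbb R^n$ carries its Euclidean structure, $B_2^n$ is its closed unit ball and $S^{n-1}$ its unit sphere. A convex body is a compact convex set with $0$ in its interior; it is centrally symmetric if $K=-K$. For a convex body $K\subset\mathbb R^n$ and $x\in K$ let $K^x=\{x+y:\langle y,z-x\rangle\le 1\ \forall z\in K\}$, and put $$S(K,t)=\{x\in K:\mathrm{Vol}(K)\,\mathrm{Vol}(K^x)\le t\,\mathrm{Vol}(B_2^n)^2\},\qquad F(K,\lambda)=\bigcap_{\theta\in S^{n-1}}\{x:\langle x,\theta\rangle\le a(\theta)\},$$ where $a(\theta)$ is determined by $\mathrm{Vol}(K\cap\{x:\langle x,\theta\rangle\ge a(\theta)\})=\lambda\,\mathrm{Vol}(K)$. A function $f:\mathbb R^n\to[0,\infty)$ is log-concave if $f(x)^{t}f(y)^{1-t}\le f(tx+(1-t)y)$ for all $x,y\in\{f>0\}$ and $0<t<1$. Put $f_a(x)=f(x-a)$, $f^\circ(x)=\inf_y e^{-\langle x,y\rangle}/f(y)$ (the quotient being $+\infty$ where $f(y)=0$), and $$S(f,t)=\Big\{a\in\mathbb R^n:\int f_a\int (f_a)^\circ\le(2\pi)^n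 t\Big\},\qquad F(f,\lambda)=\bigcap_{\theta\in S^{n-1}}\{x:\langle x,\theta\rangle\le a_f(\theta)\},$$ where $a_f(\theta)$ is determined by $\int_{\{\langle x,\theta\rangle\ge a_f(\theta)\}}f=\lambda\int f$. Theorem. Let $0<\lambda<\frac12$ and $d>0$. (a) Suppose that $S(K,d)\subseteq F(K,\lambda)$ for every centrally symmetric convex body $K$, in every dimension. Then, for every $n$, $S(f,d)\subseteq F(f,\lambda)$ for every even log-concave function $f:\mathbb R^n\to[0,\infty)$ with $0<\int f<\infty$. (b) For a given $n$, the conclusion of (a) for functions on $\mathbb R^n$ already holds if $S(K,d)\subseteq F(K,\lambda)$ for every $s\ge1$ and every centrally symmetric convex body $K\subset\mathbb R^n\times\mathbb R^s=\mathbb R^{n+s}$ for which membership of $(x,y)$ in $K$ depends only on $x$ and $|y|$. -/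

import Mathlib

open scoped NNReal ENNReal Pointwise

namespace SantaloFloating

/-- `ℝⁿ` with its Euclidean structure (and Lebesgue measure `MeasureTheory.volume`). -/
abbrev E (n : ℕ) : Type := EuclideanSpace ℝ (Fin n)

/-- A convex body: a compact convex set with `0` in its interior. -/
def IsConvexBody {n : ℕ} (K : Set (E n)) : Prop :=
  IsCompact K ∧ Convex ℝ K ∧ (0 : E n) ∈ interior K

/-- Central symmetry, `K = -K`. -/
def IsCentrallySymmetric {n : ℕ} (K : Set (E n)) : Prop :=
  K = -K

/-- The polar body of `K` with respect to `x`,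
`K^x = {x + y : ⟨y, z - x⟩ ≤ 1 for all z ∈ K}`. -/
def polarAt {n : ℕ} (K : Set (E n)) (x : E n) : Set (E n) :=
  {w | ∃ y : E n, (∀ z ∈ K, inner ℝ y (z - x) ≤ 1) ∧ w = x + y}

/-- The Santaló region of a convex body,
`S(K,t) = {x ∈ K : Vol(K) Vol(K^x) ≤ t Vol(B)²}`, where `B` is the closed Euclidean unit ball.
Volumes are extended nonnegative reals; when `x` is a boundary point of `K`, the polar has
infinite volume and `x` is not in the region. -/
def santaloBody {n : ℕ} (K : Set (E n)) (t : ℝ) : Set (E n) :=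
  {x ∈ K | MeasureTheory.volume K * MeasureTheory.volume (polarAt K x) ≤
    ENNReal.ofReal t * MeasureTheory.volume (Metric.closedBall (0 : E n) 1) ^ 2}

/-- The half-space `{x : ⟨x, θ⟩ ≥ a}`. -/
def upperHalfSpace {n : ℕ} (θ : E n) (a : ℝ) : Set (E n) :=
  {x | a ≤ inner ℝ x θ}

/-- The half-space `{x : ⟨x, θ⟩ ≤ a}`. -/
def lowerHalfSpace {n : ℕ} (θ : E n) (a : ℝ) : Set (E n) :=
  {x | inner ℝ x θ ≤ a}

/-- The floating body of a convex body: the intersection over the unit vectors `θ` of the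
half-spaces `{x : ⟨x, θ⟩ ≤ a}`, where `a = a(θ)` is the number for which `{x : ⟨x, θ⟩ ≥ a}` cuts
off the fraction `lam` of the volume (it exists and is unique for a convex body
and `0 < lam < 1`). -/
def floatingBody {n : ℕ} (K : Set (E n)) (lam : ℝ) : Set (E n) :=
  ⋂ θ ∈ Metric.sphere (0 : E n) 1,
    ⋂ a ∈ {a : ℝ | MeasureTheory.volume (upperHalfSpace θ a ∩ K) =
        ENNReal.ofReal lam * MeasureTheory.volume K},
      lowerHalfSpace θ a

/-- Log-concavity of `f : ℝⁿ → [0,∞)`, the inequality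
`t log f(x) + (1-t) log f(y) ≤ log f(t x + (1-t) y)` for `x, y` in `{f > 0}` and `0 < t < 1`,
in exponentiated form (so that the value `log 0 = -∞` on the right is excluded). -/
def IsLogConcave {n : ℕ} (f : E n → ℝ≥0) : Prop :=
  ∀ x y : E n, 0 < f x → 0 < f y → ∀ t : ℝ, 0 < t → t < 1 →
    f x ^ t * f y ^ (1 - t) ≤ f (t • x + (1 - t) • y)

/-- An even function. -/
def IsEvenFun {n : ℕ} (f : E n → ℝ≥0) : Prop :=
  ∀ x : E n, f (-x) = f x

/-- The translate `f_a(x) = f(x - a)`. -/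
def translate {n : ℕ} (f : E n → ℝ≥0) (a : E n) : E n → ℝ≥0 :=
  fun x => f (x - a)

/-- The dual function `f°(x) = inf_y e^{-⟨x,y⟩} / f(y)`; the quotient is `∞` where `f(y) = 0`. -/
noncomputable def dualFun {n : ℕ} (f : E n → ℝ≥0) (x : E n) : ℝ≥0∞ :=
  ⨅ y : E n, ENNReal.ofReal (Real.exp (-inner ℝ x y)) / (f y : ℝ≥0∞)

/-- The Santaló region of a function, `S(f,t) = {a : ∫ f_a ∫ (f_a)° ≤ (2π)ⁿ t}`. -/
def santaloFun {n : ℕ} (f : E n → ℝ≥0) (t : ℝ) : Set (E n) :=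
  {a | (∫⁻ x, (translate f a x : ℝ≥0∞)) * (∫⁻ x, dualFun (translate f a) x) ≤
    ENNReal.ofReal ((2 * Real.pi) ^ n * t)}

/-- The floating body of a function: as for a body, with volume replaced by the integral of `f`. -/
def floatingFun {n : ℕ} (f : E n → ℝ≥0) (lam : ℝ) : Set (E n) :=
  ⋂ θ ∈ Metric.sphere (0 : E n) 1,
    ⋂ a ∈ {a : ℝ | ∫⁻ x in upperHalfSpace θ a, (f x : ℝ≥0∞) =
        ENNReal.ofReal lam * ∫⁻ x, (f x : ℝ≥0∞)},
      lowerHalfSpace θ a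

/-- `K ⊆ ℝⁿ × ℝˢ = ℝⁿ⁺ˢ` is a body of revolution about `ℝⁿ` (the first `n` coordinates):
whether `(x, y)` belongs to `K` depends only on `x` and `|y|`. -/
def IsRevolution {n s : ℕ} (K : Set (E (n + s))) : Prop :=
  ∀ z w : E (n + s), (∀ i : Fin n, z (Fin.castAdd s i) = w (Fin.castAdd s i)) →
    (∑ j : Fin s, z (Fin.natAdd n j) ^ 2 = ∑ j : Fin s, w (Fin.natAdd n j) ^ 2) →
    z ∈ K → w ∈ K

/-- `S(f,d) ⊆ F(f,lam)` for every even log-concave `f : ℝⁿ → [0,∞)` with `0 < ∫ f < ∞`. -/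
def FunctionInclusion (n : ℕ) (lam d : ℝ) : Prop :=
  ∀ f : E n → ℝ≥0, IsEvenFun f → IsLogConcave f →
    0 < ∫⁻ x, (f x : ℝ≥0∞) → ∫⁻ x, (f x : ℝ≥0∞) < ⊤ →
    santaloFun f d ⊆ floatingFun f lam

end SantaloFloating

/-!
The proof attaches to an even log-concave `f` with `f 0 = 1` the bodies of revolution
`Kₛ = closure {(x, y) ∈ ℝⁿ × ℝˢ : f(x) > e⁻ˢ, |y| ≤ 1 + log f(x) / s}` (`logBody`) and lets
`s → ∞`. Write `κₛ` for the volume of the unit ball of `ℝˢ`. Slicing along `ℝⁿ` turns volumes of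
subsets of `ℝⁿ × ℝˢ` into integrals of volumes of `s`-dimensional fibres, and three limits appear.

* Almost all fibres of `Kₛ` have volume `κₛ (1 + log f / s)ˢ ≤ κₛ f`, and `(1 + log f / s)ˢ → f`.
  So `Vol(Kₛ) / κₛ` tends to `∫ f`, and the part of `Kₛ` over a half-space of `ℝⁿ` has volume at most
  `κₛ` times the integral of `f` over it (`volume_logBody_inter_le`, `le_liminf_volume_logBody`).
* A fibre of the polar of `Kₛ - (b, 0)` over `u / s` lies in the balls of radius
  `(1 - ⟨u, x - b⟩ / s) / (1 + log f(x) / s)` for all `x` with `f(x) > e⁻ˢ`. The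
  `s`-th power of this radius tends to `e^{-⟨u, x - b⟩} / f(x)`, and reverse Fatou bounds the limit
  superior of `sⁿ Vol(Kₛ^{(b,0)}) / κₛ` by `∫ (f_b)°` (`limsup_volume_recentredPolar_le`).
* The unit ball itself is a body of revolution, with fibres of volume `κₛ (1 - |x|²) ^ (s/2)`, so
  `s^{n/2} κₙ₊ₛ / κₛ` is asymptotically at least the Gaussian integral `(2π)^{n/2}`
  (`le_liminf_volume_ball`).

Hence, if `∫ f ∫ (f_b)° < (2π)ⁿ d` strictly, `(b, 0)` belongs to the Santaló region of `Kₛ` for all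
large `s` (`eventually_mem_santaloBody`), therefore to its floating body, and in the limit the
half-space through `b` with normal `θ` cuts off at least the fraction `lam` of `∫ f`
(`inner_le_of_dualIntegral_lt`).

Points `a` of the region where equality holds are reached by applying this to `b = ρ a` with
`ρ < 1`. Since `∫ (f_a)° = ∫ cosh⟨u, a⟩ f°(u) du`, the inequality becomes strict at `ρ a` unless
`a = 0` (`dualIntegral_smul_lt`), and `0` lies in the floating body because `lam < 1/2`. The
finiteness of `∫ (f_a)°` also forces `f` to be bounded below near `ρ a`
(`exists_ball_le_of_dualIntegral_ne_top`), which is what the dominated limit needs.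

An even log-concave function is not assumed measurable or semicontinuous. Upper bounds for integrals
of `f` go through monotonicity alone, lower bounds through fibre volumes of measurable sets, and the
boundaries of convex sets are null.
-/

namespace SantaloFloating

open MeasureTheory Set Filter Topology


/-! ### The splitting of `ℝⁿ⁺ˢ` -/

/-- The splitting `ℝⁿ⁺ˢ = ℝⁿ × ℝˢ` into the first `n` and the last `s` coordinates. -/
noncomputable def splitCoord (n s : ℕ) : E (n + s) ≃L[ℝ] E n × E s :=
  EuclideanSpace.finAddEquivProd

lemma splitCoord_fst_apply {n s : ℕ} (z : E (n + s)) (i : Fin n) :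
    (splitCoord n s z).1 i = z (Fin.castAdd s i) := by
  simp [splitCoord, EuclideanSpace.finAddEquivProd, EuclideanSpace.sumEquivProd]

lemma splitCoord_snd_apply {n s : ℕ} (z : E (n + s)) (j : Fin s) :
    (splitCoord n s z).2 j = z (Fin.natAdd n j) := by
  simp [splitCoord, EuclideanSpace.finAddEquivProd, EuclideanSpace.sumEquivProd]

lemma measurePreserving_splitCoord (n s : ℕ) :
    MeasurePreserving (splitCoord n s) volume volume := by
  have h1 := (LinearIsometryEquiv.piLpCongrLeft 2 ℝ ℝ
    (finSumFinEquiv (m := n) (n := s)).symm).measurePreserving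
  have h2 := (PiLp.sumPiLpEquivProdLpPiLp 2 (fun _ : Fin n ⊕ Fin s => ℝ)).measurePreserving
  have h3 := WithLp.volume_preserving_ofLp (E n) (E s)
  exact h3.comp (h2.comp h1)

lemma inner_eq_add_inner_splitCoord {n s : ℕ} (z w : E (n + s)) :
    inner ℝ z w = inner ℝ (splitCoord n s z).1 (splitCoord n s w).1 +
      inner ℝ (splitCoord n s z).2 (splitCoord n s w).2 := by
  simp [PiLp.inner_apply, Fin.sum_univ_add, splitCoord_fst_apply, splitCoord_snd_apply]

lemma norm_sq_eq_add_splitCoord {n s : ℕ} (z : E (n + s)) :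
    ‖z‖ ^ 2 = ‖(splitCoord n s z).1‖ ^ 2 + ‖(splitCoord n s z).2‖ ^ 2 := by
  simp only [← real_inner_self_eq_norm_sq, inner_eq_add_inner_splitCoord]

/-- The `s`-dimensional volume of the fibre over `x ∈ ℝⁿ` of a subset of `ℝⁿ × ℝˢ`. -/
noncomputable def sectionVol {n s : ℕ} (A : Set (E (n + s))) (x : E n) : ℝ≥0∞ :=
  volume {y : E s | (splitCoord n s).symm (x, y) ∈ A}

lemma measurable_sectionVol {n s : ℕ} {A : Set (E (n + s))} (hA : MeasurableSet A) :
    Measurable (sectionVol A) :=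
  measurable_measure_prodMk_left ((splitCoord n s).symm.continuous.measurable hA)

lemma volume_eq_lintegral_sectionVol {n s : ℕ} {A : Set (E (n + s))} (hA : MeasurableSet A) :
    volume A = ∫⁻ x, sectionVol A x := by
  have h := (measurePreserving_splitCoord n s).measure_preimage
    ((splitCoord n s).symm.continuous.measurable hA).nullMeasurableSet
  have h' : (splitCoord n s) ⁻¹' ((splitCoord n s).symm ⁻¹' A) = A := by
    ext; simp
  rw [h'] at h
  rw [h, Measure.volume_eq_prod, Measure.prod_apply ((splitCoord n s).symm.continuous.measurable hA)]
  rfl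

/-- The volume of the unit ball of `ℝˢ`. -/
noncomputable abbrev unitBallVol (s : ℕ) : ℝ≥0∞ := volume (Metric.closedBall (0 : E s) 1)

lemma unitBallVol_ne_top (s : ℕ) : unitBallVol s ≠ ⊤ := measure_closedBall_lt_top.ne

lemma unitBallVol_ne_zero (s : ℕ) : unitBallVol s ≠ 0 :=
  (Metric.measure_closedBall_pos _ _ one_pos).ne'

lemma volume_closedBall_eq {s : ℕ} {r : ℝ} (hr : 0 ≤ r) :
    volume (Metric.closedBall (0 : E s) r) = unitBallVol s * ENNReal.ofReal (r ^ s) := by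
  rw [Measure.addHaar_closedBall' _ _ hr, finrank_euclideanSpace_fin, mul_comm]

/-! ### Bodies of revolution -/

/-- The subset `{(x, y) : x ∈ D, |y| ≤ φ x}` of `ℝⁿ × ℝˢ`. -/
def revSet {n : ℕ} (s : ℕ) (D : Set (E n)) (φ : E n → ℝ) : Set (E (n + s)) :=
  {z | (splitCoord n s z).1 ∈ D ∧ ‖(splitCoord n s z).2‖ ≤ φ (splitCoord n s z).1}

lemma convex_revSet {n s : ℕ} {D : Set (E n)} {φ : E n → ℝ} (hφ : ConcaveOn ℝ D φ) :
    Convex ℝ (revSet s D φ) := by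
  intro z hz w hw a b ha hb hab
  refine ⟨?_, ?_⟩
  · simpa using hφ.1 hz.1 hw.1 ha hb hab
  · have h := hφ.2 hz.1 hw.1 ha hb hab
    simp only [map_add, map_smul, Prod.fst_add, Prod.snd_add, Prod.smul_fst, Prod.smul_snd]
    calc _ ≤ ‖a • (splitCoord n s z).2‖ + ‖b • (splitCoord n s w).2‖ := norm_add_le _ _
      _ = a * ‖(splitCoord n s z).2‖ + b * ‖(splitCoord n s w).2‖ := by
        rw [norm_smul, norm_smul, Real.norm_of_nonneg ha, Real.norm_of_nonneg hb]
      _ ≤ a * φ (splitCoord n s z).1 + b * φ (splitCoord n s w).1 :=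
        add_le_add (mul_le_mul_of_nonneg_left hz.2 ha) (mul_le_mul_of_nonneg_left hw.2 hb)
      _ ≤ _ := h

lemma neg_revSet {n s : ℕ} {D : Set (E n)} {φ : E n → ℝ} (hD : ∀ x ∈ D, -x ∈ D)
    (hφ : ∀ x, φ (-x) = φ x) : revSet s D φ = -revSet s D φ := by
  have h : ∀ z ∈ revSet s D φ, -z ∈ revSet s D φ := fun z hz =>
    ⟨by simpa using hD _ hz.1, by simpa [hφ] using hz.2⟩
  ext z
  exact ⟨fun hz => h z hz, fun hz => by simpa using h _ hz⟩

/-- Membership of `(x, y)` in the closure of `{(x, y) : x ∈ D, |y| ≤ φ x}` is membership of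
`(x, |y|)` in the closure of a subset of `ℝⁿ × ℝ`. -/
lemma mem_closure_revSet_iff {n s : ℕ} (D : Set (E n)) (φ : E n → ℝ) (x : E n) (y : E s) :
    (splitCoord n s).symm (x, y) ∈ closure (revSet s D φ) ↔
      (x, ‖y‖) ∈ closure {p : E n × ℝ | p.1 ∈ D ∧ |p.2| ≤ φ p.1} := by
  constructor
  · intro h
    have := map_mem_closure (f := fun z => ((splitCoord n s z).1, ‖(splitCoord n s z).2‖))
      (t := {p : E n × ℝ | p.1 ∈ D ∧ |p.2| ≤ φ p.1}) (by fun_prop) h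
      (fun v hv => ⟨hv.1, by simpa using hv.2⟩)
    simpa using this
  · intro h
    obtain ⟨u, hu1, hu⟩ : ∃ u : E s, ‖u‖ ≤ 1 ∧ ‖y‖ • u = y := by
      by_cases h0 : y = 0
      · exact ⟨0, by simp, by simp [h0]⟩
      · refine ⟨‖y‖⁻¹ • y, ?_, ?_⟩
        · rw [norm_smul, norm_inv, norm_norm]
          exact inv_mul_le_one
        · rw [smul_smul, mul_inv_cancel₀ (norm_ne_zero_iff.2 h0), one_smul]
    have := map_mem_closure (f := fun p : E n × ℝ => (splitCoord n s).symm (p.1, p.2 • u))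
      (t := revSet s D φ) (by fun_prop) h (fun p hp => by
        refine ⟨by simpa using hp.1, ?_⟩
        simp only [ContinuousLinearEquiv.apply_symm_apply, norm_smul, Real.norm_eq_abs]
        exact (mul_le_of_le_one_right (abs_nonneg _) hu1).trans hp.2)
    simpa only [hu] using this

lemma isRevolution_closure_revSet {n s : ℕ} (D : Set (E n)) (φ : E n → ℝ) :
    IsRevolution (closure (revSet s D φ)) := by
  intro z w hx hy hz
  have hx' : (splitCoord n s z).1 = (splitCoord n s w).1 := by
    ext i; simpa only [splitCoord_fst_apply] using hx i
  have hy' : ‖(splitCoord n s z).2‖ = ‖(splitCoord n s w).2‖ := by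
    rw [EuclideanSpace.norm_eq, EuclideanSpace.norm_eq]
    simpa only [Real.norm_eq_abs, sq_abs, splitCoord_snd_apply] using congrArg Real.sqrt hy
  have h := (mem_closure_revSet_iff D φ (splitCoord n s z).1 (splitCoord n s z).2).1
    (by simpa using hz)
  rw [hx', hy', ← mem_closure_revSet_iff] at h
  simpa using h

/-- The part of the body `closure {(x, y) : x ∈ D, |y| ≤ φ x}` over a measurable set `T` has
volume at most `κₛ ∫_T g` as soon as `φˢ ≤ g` on `D`. No measurability of `g` is needed: up to a
null set the body is its interior, whose fibres are measurable. -/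
lemma volume_closure_revSet_inter_le {n s : ℕ} {D : Set (E n)} {φ : E n → ℝ}
    (hφ : ConcaveOn ℝ D φ) (hφ0 : ∀ x ∈ D, 0 ≤ φ x) {g : E n → ℝ≥0∞}
    (hg : ∀ x ∈ D, ENNReal.ofReal (φ x ^ s) ≤ g x) {T : Set (E n)} (hT : MeasurableSet T) :
    volume ({z | (splitCoord n s z).1 ∈ T} ∩ closure (revSet s D φ)) ≤
      unitBallVol s * ∫⁻ x in T, g x := by
  have hTm : MeasurableSet {z | (splitCoord n s z).1 ∈ T} :=
    (splitCoord n s).continuous.fst.measurable hT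
  have hnull : volume (frontier (revSet s D φ)) = 0 := (convex_revSet hφ).addHaar_frontier _
  have h1 : volume ({z | (splitCoord n s z).1 ∈ T} ∩ closure (revSet s D φ)) ≤
      volume ({z | (splitCoord n s z).1 ∈ T} ∩ interior (revSet s D φ)) := by
    calc _ ≤ volume (({z | (splitCoord n s z).1 ∈ T} ∩ interior (revSet s D φ)) ∪
          frontier (revSet s D φ)) := by
          refine measure_mono ?_
          rintro z ⟨hz1, hz2⟩
          rw [closure_eq_interior_union_frontier] at hz2
          exact hz2.imp (fun h => ⟨hz1, h⟩) id
      _ ≤ _ := (measure_union_le _ _).trans (by rw [hnull, add_zero])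
  refine h1.trans ?_
  rw [volume_eq_lintegral_sectionVol (hTm.inter isOpen_interior.measurableSet),
    ← lintegral_const_mul' _ _ (unitBallVol_ne_top s), ← lintegral_indicator hT]
  refine lintegral_mono fun x => ?_
  by_cases hx : x ∈ T ∩ D
  · rw [indicator_of_mem hx.1]
    refine le_trans ?_ (mul_le_mul_right (hg x hx.2) _)
    rw [← volume_closedBall_eq (hφ0 x hx.2)]
    refine measure_mono fun y hy => ?_
    simpa using (interior_subset hy.2).2
  · have : sectionVol ({z | (splitCoord n s z).1 ∈ T} ∩ interior (revSet s D φ)) x = 0 := by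
      refine measure_mono_null (t := ∅) (fun y hy => hx ?_) measure_empty
      refine ⟨by simpa using hy.1, by simpa using (interior_subset hy.2).1⟩
    rw [this]
    exact zero_le

lemma le_sectionVol_closure_revSet {n s : ℕ} {D : Set (E n)} {φ : E n → ℝ} {x : E n}
    (hx : x ∈ D) (hφ : 0 ≤ φ x) :
    unitBallVol s * ENNReal.ofReal (φ x ^ s) ≤ sectionVol (closure (revSet s D φ)) x := by
  rw [← volume_closedBall_eq hφ]
  refine measure_mono fun y hy => subset_closure ⟨by simpa using hx, by simpa using hy⟩

/-- Boundedness and a neighbourhood of the origin make the closure a convex body. -/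
lemma isConvexBody_closure_revSet {n s : ℕ} {D : Set (E n)} {φ : E n → ℝ}
    (hφ : ConcaveOn ℝ D φ) {R r δ : ℝ} (hD : ∀ x ∈ D, ‖x‖ ≤ R) (hφR : ∀ x ∈ D, φ x ≤ 1)
    (hr : 0 < r) (hδ : 0 < δ) (hball : ∀ x, ‖x‖ < r → x ∈ D ∧ δ ≤ φ x) :
    IsConvexBody (closure (revSet s D φ)) := by
  refine ⟨?_, (convex_revSet hφ).closure, ?_⟩
  · refine Bornology.IsBounded.isCompact_closure ?_
    refine (Metric.isBounded_iff_subset_closedBall 0).2 ⟨√(R ^ 2 + 1), fun z hz => ?_⟩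
    rw [mem_closedBall_zero_iff]
    refine Real.le_sqrt_of_sq_le ?_
    rw [norm_sq_eq_add_splitCoord]
    have h1 := hD _ hz.1
    have h2 := hz.2.trans (hφR _ hz.1)
    have h3 := norm_nonneg (splitCoord n s z).1
    have h4 := norm_nonneg (splitCoord n s z).2
    nlinarith
  · refine interior_mono subset_closure ?_
    rw [mem_interior_iff_mem_nhds]
    have : (splitCoord n s) ⁻¹' (Metric.ball 0 r ×ˢ Metric.ball 0 δ) ∈ 𝓝 (0 : E (n + s)) := by
      refine (splitCoord n s).continuous.continuousAt.preimage_mem_nhds ?_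
      rw [map_zero]
      exact prod_mem_nhds (Metric.ball_mem_nhds _ hr) (Metric.ball_mem_nhds _ hδ)
    refine mem_of_superset this fun z hz => ?_
    have h1 : ‖(splitCoord n s z).1‖ < r := by simpa using hz.1
    have h2 : ‖(splitCoord n s z).2‖ < δ := by simpa using hz.2
    exact ⟨(hball _ h1).1, h2.le.trans (hball _ h1).2⟩


/-! ### Cutting off a fraction of the volume -/

lemma measurableSet_upperHalfSpace {n : ℕ} (θ : E n) (a : ℝ) :
    MeasurableSet (upperHalfSpace θ a) :=
  measurableSet_le measurable_const (by fun_prop)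

lemma ae_inner_ne {n : ℕ} {θ : E n} (hθ : θ ≠ 0) (a : ℝ) :
    ∀ᵐ x : E n, inner ℝ x θ ≠ a := by
  have hsurj : Function.Surjective ((innerSL ℝ θ : E n →L[ℝ] ℝ) : E n →ₗ[ℝ] ℝ) := by
    refine LinearMap.surjective fun h => hθ ?_
    have := congrArg (fun L => L θ) h
    simpa using this
  have := (ae_comp_linearMap_mem_iff _ (volume : Measure (E n))
    (volume : Measure ℝ) hsurj (s := {a}ᶜ) (measurableSet_singleton a).compl).2
    (by simp [ae_iff])
  filter_upwards [this] with x hx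
  rw [real_inner_comm]
  simpa using hx

/-- By the intermediate value theorem every fraction of the volume of a compact set is cut off by
some half-space with a given normal. -/
lemma exists_volume_upperHalfSpace_inter_eq {n : ℕ} {K : Set (E n)} (hK : IsCompact K)
    {θ : E n} (hθ : θ ≠ 0) {lam : ℝ} (h0 : 0 ≤ lam) (h1 : lam ≤ 1) :
    ∃ a : ℝ, volume (upperHalfSpace θ a ∩ K) = ENNReal.ofReal lam * volume K := by
  have hfin : volume K ≠ ⊤ := hK.measure_lt_top.ne
  have : IsFiniteMeasure (volume.restrict K) := ⟨by simpa using hK.measure_lt_top⟩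
  set F : ℝ → ℝ := fun a => ∫ x in K, (upperHalfSpace θ a).indicator (fun _ => (1 : ℝ)) x with hF
  have hFv : ∀ a, F a = (volume (upperHalfSpace θ a ∩ K)).toReal := by
    intro a
    rw [hF]
    simp only
    rw [integral_indicator_const _ (measurableSet_upperHalfSpace θ a)]
    simp [Measure.real, Measure.restrict_apply (measurableSet_upperHalfSpace θ a)]
  have hcont : Continuous F := by
    refine continuous_iff_continuousAt.2 fun a => ?_
    refine continuousAt_of_dominated (bound := fun _ => 1) ?_ ?_ (integrable_const _) ?_
    · exact Eventually.of_forall fun b =>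
        (measurable_const.indicator (measurableSet_upperHalfSpace θ b)).aestronglyMeasurable
    · exact Eventually.of_forall fun b => Eventually.of_forall fun x =>
        (norm_indicator_le_norm_self _ _).trans (by simp)
    · filter_upwards [ae_restrict_of_ae (ae_inner_ne hθ a)] with x hx
      rcases lt_or_gt_of_ne hx with h | h
      · have : (fun b => (upperHalfSpace θ b).indicator (fun _ => (1 : ℝ)) x) =ᶠ[𝓝 a]
            fun _ => 0 := by
          filter_upwards [lt_mem_nhds h] with b hb
          exact indicator_of_notMem (by simpa [upperHalfSpace] using hb) _
        exact continuousAt_const.congr this.symm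
      · have : (fun b => (upperHalfSpace θ b).indicator (fun _ => (1 : ℝ)) x) =ᶠ[𝓝 a]
            fun _ => 1 := by
          filter_upwards [gt_mem_nhds h] with b hb
          exact indicator_of_mem (by simpa [upperHalfSpace] using hb.le) _
        exact continuousAt_const.congr this.symm
  obtain ⟨R, hR⟩ : ∃ R : ℝ, ∀ x ∈ K, |inner ℝ x θ| ≤ R := by
    obtain ⟨R, hR⟩ := hK.exists_bound_of_continuousOn (f := fun x => (inner ℝ x θ : ℝ))
      (by fun_prop)
    exact ⟨R, fun x hx => by simpa using hR x hx⟩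
  have hlow : F (-R) = (volume K).toReal := by
    rw [hFv]
    congr 2
    exact inter_eq_right.2 fun x hx => (abs_le.1 (hR x hx)).1
  have hup : F (R + 1) = 0 := by
    rw [hFv]
    have : upperHalfSpace θ (R + 1) ∩ K = ∅ := by
      refine eq_empty_of_forall_notMem fun x hx => ?_
      have h1 : R + 1 ≤ inner ℝ x θ := hx.1
      have h2 := (abs_le.1 (hR x hx.2)).2
      linarith
    simp [this]
  obtain ⟨a, ha⟩ : ∃ a, F a = lam * (volume K).toReal := by
    refine mem_range_of_exists_le_of_exists_ge hcont ⟨R + 1, ?_⟩ ⟨-R, ?_⟩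
    · rw [hup]; positivity
    · rw [hlow]; exact mul_le_of_le_one_left ENNReal.toReal_nonneg h1
  refine ⟨a, ?_⟩
  rw [hFv] at ha
  rw [← ENNReal.toReal_eq_toReal_iff' (measure_ne_top_of_subset inter_subset_right hfin)
    (ENNReal.mul_ne_top ENNReal.ofReal_ne_top hfin), ha, ENNReal.toReal_mul,
    ENNReal.toReal_ofReal h0]

/-- A half-space whose boundary passes through a point of the floating body cuts off at least the
prescribed fraction of the volume. -/
lemma volume_le_of_mem_floatingBody {n : ℕ} {K : Set (E n)} (hK : IsCompact K) {lam : ℝ}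
    (h0 : 0 ≤ lam) (h1 : lam ≤ 1) {x : E n} (hx : x ∈ floatingBody K lam) {θ : E n}
    (hθ : ‖θ‖ = 1) :
    ENNReal.ofReal lam * volume K ≤ volume (upperHalfSpace θ (inner ℝ x θ) ∩ K) := by
  obtain ⟨a, ha⟩ := exists_volume_upperHalfSpace_inter_eq hK
    (norm_ne_zero_iff.1 (by rw [hθ]; exact one_ne_zero)) h0 h1
  have hxa : inner ℝ x θ ≤ a := by
    simp only [floatingBody, mem_iInter] at hx
    exact hx θ (by simpa using hθ) a ha
  rw [← ha]
  exact measure_mono (inter_subset_inter_left _ fun z hz => hxa.trans hz)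

/-! ### Polars of bodies of revolution -/

/-- The polar of `K - x`, that is, `K^x - x`. -/
def recentredPolar {n : ℕ} (K : Set (E n)) (x : E n) : Set (E n) :=
  {y | ∀ z ∈ K, inner ℝ y (z - x) ≤ 1}

lemma volume_polarAt {n : ℕ} (K : Set (E n)) (x : E n) :
    volume (polarAt K x) = volume (recentredPolar K x) := by
  have : polarAt K x = (fun w => w - x) ⁻¹' recentredPolar K x := by
    ext w
    constructor
    · rintro ⟨y, hy, rfl⟩
      simpa [recentredPolar] using hy
    · intro hw
      exact ⟨w - x, hw, by simp⟩
  simp only [this, sub_eq_add_neg, measure_preimage_add_right]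

lemma measurableSet_recentredPolar {n : ℕ} (K : Set (E n)) (x : E n) :
    MeasurableSet (recentredPolar K x) := by
  refine IsClosed.measurableSet ?_
  have : recentredPolar K x = ⋂ z ∈ K, {y | inner ℝ y (z - x) ≤ 1} := by
    ext; simp [recentredPolar]
  rw [this]
  exact isClosed_biInter fun z _ => isClosed_le (by fun_prop) continuous_const

/-- Every point `(x, φ x)` of the profile bounds the radius of the fibres of the polar body. -/
lemma sectionVol_recentredPolar_le {n s : ℕ} {D : Set (E n)} {φ : E n → ℝ} {x : E n}
    (hx : x ∈ D) (hφ : 0 < φ x) (b u : E n) :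
    sectionVol (recentredPolar (closure (revSet s D φ)) ((splitCoord n s).symm (b, 0))) u ≤
      unitBallVol s * ENNReal.ofReal ((max 0 (1 - inner ℝ u (x - b)) / φ x) ^ s) := by
  rw [← volume_closedBall_eq (by positivity)]
  refine measure_mono fun v hv => ?_
  rw [mem_closedBall_zero_iff, le_div_iff₀ hφ]
  refine le_trans ?_ (le_max_right _ _)
  obtain ⟨e, he1, he⟩ : ∃ e : E s, ‖e‖ ≤ 1 ∧ inner ℝ v e = ‖v‖ := by
    by_cases h0 : v = 0
    · exact ⟨0, by simp, by simp [h0]⟩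
    · refine ⟨‖v‖⁻¹ • v, ?_, ?_⟩
      · rw [norm_smul, norm_inv, norm_norm]
        exact inv_mul_le_one
      · rw [inner_smul_right, real_inner_self_eq_norm_sq, sq, ← mul_assoc,
          inv_mul_cancel₀ (norm_ne_zero_iff.2 h0), one_mul]
  have hmem : (splitCoord n s).symm (x, φ x • e) ∈ closure (revSet s D φ) := by
    refine subset_closure ⟨by simpa using hx, ?_⟩
    simp only [ContinuousLinearEquiv.apply_symm_apply, norm_smul, Real.norm_of_nonneg hφ.le]
    exact mul_le_of_le_one_right hφ.le he1
  have h := hv _ hmem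
  rw [inner_eq_add_inner_splitCoord, map_sub] at h
  simp only [ContinuousLinearEquiv.apply_symm_apply, Prod.fst_sub, Prod.snd_sub, sub_zero,
    inner_smul_right, he] at h
  linarith [mul_comm ‖v‖ (φ x)]

/-! ### The volume of the unit ball of `ℝⁿ⁺ˢ` as `s → ∞` -/

lemma lintegral_comp_inv_smul {n : ℕ} {h : E n → ℝ≥0∞} (hh : Measurable h) {c : ℝ} (hc : 0 < c) :
    ∫⁻ x, h (c⁻¹ • x) = ENNReal.ofReal (c ^ n) * ∫⁻ x, h x := by
  have h1 := lintegral_map (μ := (volume : Measure (E n))) hh (measurable_const_smul c⁻¹)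
  rw [← h1, Measure.map_addHaar_smul _ (inv_ne_zero hc.ne'), lintegral_smul_measure,
    finrank_euclideanSpace_fin, smul_eq_mul, inv_pow, inv_inv, abs_of_pos (by positivity)]

lemma lintegral_exp_neg_norm_sq (n : ℕ) :
    ∫⁻ x : E n, ENNReal.ofReal (Real.exp (-(1 / 2) * ‖x‖ ^ 2)) =
      ENNReal.ofReal (√(2 * Real.pi) ^ n) := by
  have h := GaussianFourier.integral_rexp_neg_mul_sq_norm (V := E n) (b := 1 / 2) (by norm_num)
  rw [← ofReal_integral_eq_lintegral_ofReal, h]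
  · congr 1
    rw [finrank_euclideanSpace_fin, Real.sqrt_eq_rpow, ← Real.rpow_natCast, ← Real.rpow_mul
      (by positivity)]
    congr 1 <;> ring
  · refine Integrable.of_integral_ne_zero ?_
    rw [h]
    positivity
  · exact Eventually.of_forall fun x => (Real.exp_pos _).le

lemma sqrt_pow_tendsto_exp (t : ℝ) :
    Tendsto (fun s : ℕ => √(1 + -t / s) ^ s) atTop (𝓝 (Real.exp (-(1 / 2) * t))) := by
  have h := (Real.tendsto_one_add_div_pow_exp (-t)).sqrt
  have he : √(Real.exp (-t)) = Real.exp (-(1 / 2) * t) := by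
    rw [Real.sqrt_eq_iff_mul_self_eq (Real.exp_pos _).le (Real.exp_pos _).le, ← Real.exp_add]
    congr 1; ring
  rw [he] at h
  refine h.congr' ?_
  obtain ⟨N, hN⟩ := exists_nat_gt |t|
  filter_upwards [eventually_ge_atTop N, eventually_gt_atTop 0] with s hs hs0
  have hs0' : (0 : ℝ) < s := by exact_mod_cast hs0
  have : 0 ≤ 1 + -t / s := by
    have : t ≤ s := (le_abs_self t).trans (hN.le.trans (by exact_mod_cast hs))
    have := (div_le_one hs0').2 this
    rw [neg_div]; linarith
  exact (Real.sqrt_eq_iff_mul_self_eq (by positivity) (by positivity)).2 (by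
    rw [← mul_pow, Real.mul_self_sqrt this])

/-- With `κₛ` the volume of the unit ball of `ℝˢ`, the quotient `s^{n/2} κₙ₊ₛ / κₛ` is
asymptotically at least `(2π)^{n/2}`: slicing the ball, it is the integral of
`(1 - |x|²/s)^{s/2}`, which tends to a Gaussian. -/
lemma le_liminf_volume_ball (n : ℕ) :
    ENNReal.ofReal (√(2 * Real.pi) ^ n) ≤
      liminf (fun s : ℕ => ENNReal.ofReal (√s ^ n) * unitBallVol (n + s) / unitBallVol s) atTop := by
  have hB : ∀ s, MeasurableSet (Metric.closedBall (0 : E (n + s)) 1) := fun s =>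
    Metric.isClosed_closedBall.measurableSet
  set q : ℕ → E n → ℝ≥0∞ := fun s x =>
    sectionVol (Metric.closedBall (0 : E (n + s)) 1) ((√(s : ℝ))⁻¹ • x) / unitBallVol s with hq
  have hqm : ∀ s, Measurable (q s) := fun s =>
    ((measurable_sectionVol (hB s)).comp (measurable_const_smul _)).div_const _
  have hint : ∀ᶠ s : ℕ in atTop, ∫⁻ x, q s x =
      ENNReal.ofReal (√s ^ n) * unitBallVol (n + s) / unitBallVol s := by
    filter_upwards [eventually_gt_atTop 0] with s hs
    have hs' : 0 < √(s : ℝ) := Real.sqrt_pos.2 (by exact_mod_cast hs)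
    simp only [hq, div_eq_mul_inv]
    rw [lintegral_mul_const' _ _ (ENNReal.inv_ne_top.2 (unitBallVol_ne_zero s)),
      lintegral_comp_inv_smul (measurable_sectionVol (hB s)) hs',
      ← volume_eq_lintegral_sectionVol (hB s)]
  rw [← lintegral_exp_neg_norm_sq]
  refine le_trans ?_ ((lintegral_liminf_le hqm).trans_eq (liminf_congr hint))
  refine lintegral_mono fun x => ?_
  have ht := (ENNReal.continuous_ofReal.tendsto _).comp (sqrt_pow_tendsto_exp (‖x‖ ^ 2))
  refine ht.liminf_eq.symm.le.trans (liminf_le_liminf ?_)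
  obtain ⟨N, hN⟩ := exists_nat_gt (‖x‖ ^ 2)
  filter_upwards [eventually_ge_atTop N, eventually_gt_atTop 0] with s hs hs0
  have hs0' : (0 : ℝ) < s := by exact_mod_cast hs0
  simp only [hq, Function.comp]
  rw [ENNReal.le_div_iff_mul_le (Or.inl (unitBallVol_ne_zero s)) (Or.inl (unitBallVol_ne_top s)),
    mul_comm, ← volume_closedBall_eq (Real.sqrt_nonneg _)]
  have h1 : 0 ≤ 1 + -‖x‖ ^ 2 / s := by
    have : ‖x‖ ^ 2 ≤ s := hN.le.trans (by exact_mod_cast hs)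
    have := (div_le_one hs0').2 this
    rw [neg_div]; linarith
  refine measure_mono fun y hy => ?_
  rw [mem_closedBall_zero_iff] at hy
  have hy2 := (Real.le_sqrt (norm_nonneg _) h1).1 hy
  change _ ∈ Metric.closedBall _ _
  rw [mem_closedBall_zero_iff, ← sq_le_one_iff₀ (norm_nonneg _), norm_sq_eq_add_splitCoord]
  simp only [ContinuousLinearEquiv.apply_symm_apply, norm_smul, norm_inv, mul_pow, inv_pow,
    Real.norm_eq_abs, sq_abs, Real.sq_sqrt hs0'.le]
  rw [neg_div] at hy2
  rw [← div_eq_inv_mul]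
  linarith


/-! ### Even log-concave functions -/

lemma IsLogConcave.min_le {n : ℕ} {f : E n → ℝ≥0} (hf : IsLogConcave f) (x y : E n) {t : ℝ}
    (h0 : 0 ≤ t) (h1 : t ≤ 1) : min (f x) (f y) ≤ f (t • x + (1 - t) • y) := by
  rcases h0.eq_or_lt with rfl | h0
  · simp
  rcases h1.eq_or_lt with rfl | h1
  · simp
  rcases eq_or_ne (min (f x) (f y)) 0 with hm | hm
  · rw [hm]; exact zero_le
  have hpos : 0 < min (f x) (f y) := pos_iff_ne_zero.2 hm
  calc min (f x) (f y) = min (f x) (f y) ^ t * min (f x) (f y) ^ (1 - t) := by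
        rw [← NNReal.rpow_add hm]; simp
    _ ≤ f x ^ t * f y ^ (1 - t) := by
        gcongr
        · exact min_le_left _ _
        · exact min_le_right _ _
    _ ≤ _ := hf x y (hpos.trans_le (min_le_left _ _)) (hpos.trans_le (min_le_right _ _)) t h0 h1

lemma IsLogConcave.convex_lt {n : ℕ} {f : E n → ℝ≥0} (hf : IsLogConcave f) (c : ℝ≥0) :
    Convex ℝ {x | c < f x} := by
  intro x hx y hy a b ha hb hab
  have hb' : b = 1 - a := by linarith
  subst hb'
  exact (lt_min hx hy).trans_le (hf.min_le x y ha (by linarith))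

lemma IsLogConcave.le_apply_zero {n : ℕ} {f : E n → ℝ≥0} (hf : IsLogConcave f)
    (he : IsEvenFun f) (x : E n) : f x ≤ f 0 := by
  have h := hf.min_le x (-x) (t := 1 / 2) (by norm_num) (by norm_num)
  rw [he x, min_self] at h
  convert h using 2
  rw [smul_neg]
  norm_num

/-- A superlevel set of positive measure is convex and symmetric, so it contains a ball around
the origin. -/
lemma IsLogConcave.exists_ball_le {n : ℕ} {f : E n → ℝ≥0} (hf : IsLogConcave f)
    (he : IsEvenFun f) (hpos : 0 < ∫⁻ x, (f x : ℝ≥0∞)) :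
    ∃ r > 0, ∃ c : ℝ≥0, 0 < c ∧ ∀ x, ‖x‖ < r → c ≤ f x := by
  obtain ⟨k, hk⟩ : ∃ k : ℕ, volume {x | ((k : ℝ≥0) + 1)⁻¹ < f x} ≠ 0 := by
    by_contra! h
    refine hpos.ne' ?_
    have h0 : ∀ᵐ x : E n, (f x : ℝ≥0∞) = 0 := by
      have : ∀ᵐ x : E n, ∀ k : ℕ, ¬ ((k : ℝ≥0) + 1)⁻¹ < f x :=
        ae_all_iff.2 fun k => by simpa only [ae_iff, not_not] using h k
      filter_upwards [this] with x hx
      by_contra hne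
      have hfx : 0 < f x := pos_iff_ne_zero.2 (by simpa using hne)
      obtain ⟨k, hk⟩ := NNReal.exists_nat_pos_inv_lt hfx
      refine hx k (lt_of_le_of_lt ?_ hk.2)
      have : (0 : ℝ≥0) < k := by exact_mod_cast hk.1
      gcongr
      exact le_self_add
    rw [lintegral_congr_ae h0]
    simp
  set c : ℝ≥0 := ((k : ℝ≥0) + 1)⁻¹ with hc
  have hconv := hf.convex_lt c
  obtain ⟨z, hz⟩ : (interior {x | c < f x}).Nonempty := by
    by_contra hne
    rw [not_nonempty_iff_eq_empty] at hne
    refine hk (measure_mono_null (fun x hx => ?_) (hconv.addHaar_frontier volume))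
    rw [frontier, hne, sdiff_empty]
    exact subset_closure hx
  obtain ⟨r, hr, hball⟩ := Metric.isOpen_iff.1 isOpen_interior z hz
  have hlt : ∀ x, ‖x‖ < r → c < f (z + x) := fun x hx => by
    have : z + x ∈ {x | c < f x} :=
      interior_subset (hball (by simpa [Metric.mem_ball, dist_eq_norm] using hx))
    exact this
  refine ⟨r, hr, c, by positivity, fun x hx => ?_⟩
  have h1 : c < f (z + x) := hlt x hx
  have h2 : c < f (-z + x) := by
    rw [← he, neg_add, neg_neg]
    exact hlt (-x) (by rwa [norm_neg])
  have h := hconv h1 h2 (a := 1 / 2) (b := 1 / 2) (by norm_num) (by norm_num) (by norm_num)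
  have hx' : (1 / 2 : ℝ) • (z + x) + (1 / 2 : ℝ) • (-z + x) = x := by module
  rw [hx'] at h
  exact le_of_lt h

/-- If `f` is at least `t` at a point far from the origin, it is bounded below on many disjoint
balls of the same radius, centred on the segment from the origin to that point. So the superlevel
sets of an integrable `f` are bounded. -/
lemma IsLogConcave.exists_norm_le {n : ℕ} {f : E n → ℝ≥0} (hf : IsLogConcave f)
    (he : IsEvenFun f) (hpos : 0 < ∫⁻ x, (f x : ℝ≥0∞)) (hfin : ∫⁻ x, (f x : ℝ≥0∞) < ⊤)
    {t : ℝ≥0} (ht : 0 < t) : ∃ R > 0, ∀ x, t ≤ f x → ‖x‖ ≤ R := by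
  obtain ⟨r, hr, c, hc, hball⟩ := hf.exists_ball_le he hpos
  set m := min t c with hm
  have hm0 : 0 < m := lt_min ht hc
  set V : ℝ≥0∞ := m * volume (Metric.ball (0 : E n) (r / 2)) with hV
  have hV0 : V ≠ 0 := mul_ne_zero (by simpa using hm0.ne')
    (Metric.measure_ball_pos _ _ (by positivity)).ne'
  obtain ⟨N, hN⟩ := ENNReal.exists_nat_mul_gt hV0 hfin.ne
  refine ⟨2 * (N + 1) * r, by positivity, fun x hx => ?_⟩
  by_contra! hlt
  have hx0 : 0 < ‖x‖ := lt_trans (by positivity) hlt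
  set p : ℕ → E n := fun k => (k * r / ‖x‖) • x with hp
  have hdisj : (↑(Finset.range N) : Set ℕ).PairwiseDisjoint fun k => Metric.ball (p k) (r / 2) := by
    intro i _ j _ hij
    refine Metric.ball_disjoint_ball ?_
    have h1 : p i - p j = (((i : ℝ) - j) * r / ‖x‖) • x := by
      simp only [hp]; rw [← sub_smul]; congr 1; ring
    have h2 : (1 : ℝ) ≤ |(i : ℝ) - j| := by
      have : (i : ℤ) - j ≠ 0 := by
        intro h; exact hij (by exact_mod_cast sub_eq_zero.1 h)
      exact_mod_cast Int.one_le_abs this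
    rw [dist_eq_norm, h1, norm_smul, Real.norm_eq_abs, abs_div, abs_mul, abs_norm,
      div_mul_cancel₀ _ hx0.ne', abs_of_pos hr]
    nlinarith
  have hle : ∀ k ∈ Finset.range N, ∀ w ∈ Metric.ball (p k) (r / 2), m ≤ f w := by
    intro k hk w hw
    set τ : ℝ := k * r / ‖x‖ with hτ
    have hkN : (k : ℝ) ≤ N := by exact_mod_cast (Finset.mem_range.1 hk).le
    have hτ0 : 0 ≤ τ := by positivity
    have hτ1 : τ ≤ 1 / 2 := by
      rw [hτ, div_le_iff₀ hx0]
      nlinarith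
    have h1 : 0 < 1 - τ := by linarith
    have hv : ‖(1 - τ)⁻¹ • (w - p k)‖ < r := by
      rw [norm_smul, norm_inv, Real.norm_of_nonneg h1.le, inv_mul_lt_iff₀ h1]
      rw [Metric.mem_ball, dist_eq_norm] at hw
      nlinarith
    have h := hf.min_le x ((1 - τ)⁻¹ • (w - p k)) hτ0 (by linarith)
    rw [smul_smul, mul_inv_cancel₀ h1.ne', one_smul] at h
    have hw' : τ • x + (w - p k) = w := by simp [hp, hτ]
    rw [hw'] at h
    exact (min_le_min hx (hball _ hv)).trans h
  have hsum : N * V ≤ ∫⁻ x, (f x : ℝ≥0∞) := by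
    calc N * V = ∫⁻ w in ⋃ k ∈ Finset.range N, Metric.ball (p k) (r / 2), (m : ℝ≥0∞) := by
          rw [setLIntegral_const, measure_biUnion_finset hdisj fun _ _ => measurableSet_ball]
          simp only [Measure.addHaar_ball_center, Finset.sum_const, Finset.card_range, hV]
          rw [nsmul_eq_mul]; ring
      _ ≤ ∫⁻ w in ⋃ k ∈ Finset.range N, Metric.ball (p k) (r / 2), (f w : ℝ≥0∞) := by
          refine setLIntegral_mono' (Finset.measurableSet_biUnion _ fun _ _ => measurableSet_ball) ?_
          intro w hw
          simp only [mem_iUnion] at hw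
          obtain ⟨k, hk, hw⟩ := hw
          exact_mod_cast hle k hk w hw
      _ ≤ _ := setLIntegral_le_lintegral _ _
  exact absurd hN (not_lt.2 hsum)

/-- Along a ray, log-concavity turns the boundedness of one superlevel set into exponential
decay. -/
lemma IsLogConcave.exists_le_exp {n : ℕ} {f : E n → ℝ≥0} (hf : IsLogConcave f)
    (he : IsEvenFun f) (hone : f 0 = 1) (hpos : 0 < ∫⁻ x, (f x : ℝ≥0∞))
    (hfin : ∫⁻ x, (f x : ℝ≥0∞) < ⊤) :
    ∃ R > 0, ∀ x, (f x : ℝ) ≤ Real.exp (1 - ‖x‖ / R) := by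
  have hexp : 0 < (Real.exp (-1)).toNNReal := Real.toNNReal_pos.2 (Real.exp_pos _)
  obtain ⟨R, hR, h⟩ := hf.exists_norm_le he hpos hfin hexp
  refine ⟨R + 1, by linarith, fun x => ?_⟩
  rcases le_or_gt ‖x‖ (R + 1) with hx | hx
  · have h1 : (f x : ℝ) ≤ 1 := by exact_mod_cast hone ▸ hf.le_apply_zero he x
    refine h1.trans (Real.one_le_exp ?_)
    rw [sub_nonneg, div_le_one (by linarith)]
    exact hx
  rcases eq_or_ne (f x) 0 with h0 | h0
  · rw [h0]; exact (Real.exp_pos _).le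
  have hx0 : 0 < ‖x‖ := by linarith
  set τ : ℝ := (R + 1) / ‖x‖ with hτ
  have hτ0 : 0 < τ := by positivity
  have hτ1 : τ < 1 := (div_lt_one hx0).2 hx
  have h1 := hf x 0 (pos_iff_ne_zero.2 h0) (by simp [hone]) τ hτ0 hτ1
  rw [hone, NNReal.one_rpow, mul_one, smul_zero, add_zero] at h1
  have h2 : f (τ • x) < (Real.exp (-1)).toNNReal := by
    by_contra! hcon
    have := h _ hcon
    rw [norm_smul, Real.norm_of_nonneg hτ0.le, hτ, div_mul_cancel₀ _ hx0.ne'] at this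
    linarith
  have h3 : (f x : ℝ) ^ τ ≤ Real.exp (-1) := by
    have := NNReal.coe_le_coe.2 (h1.trans h2.le)
    rwa [Real.coe_toNNReal _ (Real.exp_pos _).le, NNReal.coe_rpow] at this
  have hfx : (0 : ℝ) < f x := by exact_mod_cast pos_iff_ne_zero.2 h0
  have h4 : τ * Real.log (f x) ≤ -1 := by
    have := Real.log_le_log (Real.rpow_pos_of_pos hfx τ) h3
    rwa [Real.log_rpow hfx, Real.log_exp] at this
  rw [← Real.log_le_iff_le_exp hfx]
  have h5 : Real.log (f x) ≤ -(‖x‖ / (R + 1)) := by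
    have : ‖x‖ / (R + 1) = 1 / τ := by rw [hτ, one_div_div]
    rw [this, ← neg_div, le_div_iff₀ hτ0]
    linarith
  linarith

/-! ### The dual function -/

lemma dualFun_neg {n : ℕ} {f : E n → ℝ≥0} (he : IsEvenFun f) (u : E n) :
    dualFun f (-u) = dualFun f u := by
  unfold dualFun
  refine (Equiv.neg (E n)).iInf_congr fun y => ?_
  simp [he y]

lemma dualFun_translate {n : ℕ} (f : E n → ℝ≥0) (a u : E n) :
    dualFun (translate f a) u = ENNReal.ofReal (Real.exp (-inner ℝ u a)) * dualFun f u := by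
  unfold dualFun translate
  rw [ENNReal.mul_iInf_of_ne (by simpa using Real.exp_pos _) ENNReal.ofReal_ne_top]
  refine (Equiv.subRight a).iInf_congr fun y => ?_
  simp only [Equiv.subRight_apply]
  rw [← mul_div_assoc, ← ENNReal.ofReal_mul (Real.exp_pos _).le, ← Real.exp_add, inner_sub_right]
  congr 3
  ring

lemma measurable_dualFun {n : ℕ} (f : E n → ℝ≥0) : Measurable (dualFun f) := by
  refine UpperSemicontinuous.measurable (upperSemicontinuous_iInf fun y => ?_)
  refine Continuous.upperSemicontinuous ?_
  by_cases h : f y = 0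
  · have : (fun x : E n => ENNReal.ofReal (Real.exp (-inner ℝ x y)) / (f y : ℝ≥0∞)) =
        fun _ => ⊤ := by
      ext x
      rw [h]
      exact ENNReal.div_zero (by simpa using Real.exp_pos _)
    rw [this]
    exact continuous_const
  · exact ENNReal.continuous_div_const _ (by simpa using h) |>.comp
      (ENNReal.continuous_ofReal.comp (by fun_prop))

lemma dualFun_le_one {n : ℕ} {f : E n → ℝ≥0} (hone : f 0 = 1) (u : E n) : dualFun f u ≤ 1 :=
  (iInf_le _ 0).trans (by simp [hone])

/-- `∫ e^{-⟨u,a⟩} f°(u) du`, the integral of the dual of the translate `f_a`. -/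
noncomputable def dualIntegral {n : ℕ} (f : E n → ℝ≥0) (a : E n) : ℝ≥0∞ :=
  ∫⁻ u, ENNReal.ofReal (Real.exp (-inner ℝ u a)) * dualFun f u

lemma lintegral_dualFun_translate {n : ℕ} (f : E n → ℝ≥0) (a : E n) :
    ∫⁻ u, dualFun (translate f a) u = dualIntegral f a :=
  lintegral_congr fun u => dualFun_translate f a u

lemma dualIntegral_eq_exp_pos {n : ℕ} {f : E n → ℝ≥0} (he : IsEvenFun f) (a : E n) :
    dualIntegral f a = ∫⁻ u, ENNReal.ofReal (Real.exp (inner ℝ u a)) * dualFun f u := by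
  have := (Measure.measurePreserving_neg (volume : Measure (E n))).lintegral_comp_emb
    (MeasurableEquiv.neg (E n)).measurableEmbedding
    (fun u => ENNReal.ofReal (Real.exp (-inner ℝ u a)) * dualFun f u)
  rw [dualIntegral, ← this]
  refine lintegral_congr fun u => ?_
  rw [dualFun_neg he, inner_neg_left, neg_neg]

lemma dualIntegral_eq_cosh {n : ℕ} {f : E n → ℝ≥0} (he : IsEvenFun f) (a : E n) :
    dualIntegral f a = ∫⁻ u, ENNReal.ofReal (Real.cosh (inner ℝ u a)) * dualFun f u := by
  have hm := measurable_dualFun f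
  have h2 : dualIntegral f a + dualIntegral f a =
      2 * ∫⁻ u, ENNReal.ofReal (Real.cosh (inner ℝ u a)) * dualFun f u := by
    nth_rewrite 1 [dualIntegral_eq_exp_pos he]
    rw [dualIntegral, ← lintegral_add_left (by fun_prop), ← lintegral_const_mul _ (by fun_prop)]
    refine lintegral_congr fun u => ?_
    rw [← add_mul, ← mul_assoc, ← ENNReal.ofReal_add (Real.exp_pos _).le (Real.exp_pos _).le]
    congr 1
    have hcosh : Real.exp (inner ℝ u a) + Real.exp (-inner ℝ u a) =
        2 * Real.cosh (inner ℝ u a) := by rw [Real.cosh_eq]; ring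
    rw [hcosh, ENNReal.ofReal_mul (by norm_num), ENNReal.ofReal_ofNat]
  rw [← two_mul] at h2
  exact (ENNReal.mul_right_inj (by norm_num) (by norm_num)).1 h2

lemma exists_pos_le_dualFun {n : ℕ} {f : E n → ℝ≥0} (hf : IsLogConcave f)
    (he : IsEvenFun f) (hone : f 0 = 1) (hpos : 0 < ∫⁻ x, (f x : ℝ≥0∞))
    (hfin : ∫⁻ x, (f x : ℝ≥0∞) < ⊤) :
    ∃ η > 0, ∀ u : E n, ‖u‖ < η → 0 < dualFun f u := by
  obtain ⟨R, hR, h⟩ := hf.exists_le_exp he hone hpos hfin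
  refine ⟨1 / R, by positivity, fun u hu => ?_⟩
  refine lt_of_lt_of_le (b := ENNReal.ofReal (Real.exp (-1))) (by simpa using Real.exp_pos _) ?_
  refine le_iInf fun y => ?_
  rcases eq_or_ne (f y) 0 with h0 | h0
  · rw [h0, ENNReal.coe_zero, ENNReal.div_zero (by simpa using Real.exp_pos _)]
    exact le_top
  rw [ENNReal.le_div_iff_mul_le (Or.inl (by simpa using h0)) (Or.inl ENNReal.coe_ne_top),
    ← ENNReal.ofReal_coe_nnreal, ← ENNReal.ofReal_mul (Real.exp_pos _).le]
  refine ENNReal.ofReal_le_ofReal ?_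
  calc Real.exp (-1) * f y ≤ Real.exp (-1) * Real.exp (1 - ‖y‖ / R) := by
        gcongr; exact h y
    _ = Real.exp (-(1 / R * ‖y‖)) := by rw [← Real.exp_add]; congr 1; ring
    _ ≤ _ := by
        refine Real.exp_le_exp.2 (neg_le_neg ((real_inner_le_norm u y).trans ?_))
        gcongr

/-- The integral of `(f_a)°` is strictly increasing along rays from the origin: after symmetrizing
it is `∫ cosh⟨u,a⟩ f°(u) du`. -/
lemma dualIntegral_smul_lt {n : ℕ} {f : E n → ℝ≥0} (hf : IsLogConcave f)
    (he : IsEvenFun f) (hone : f 0 = 1) (hpos : 0 < ∫⁻ x, (f x : ℝ≥0∞))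
    (hfin : ∫⁻ x, (f x : ℝ≥0∞) < ⊤) {a : E n} (ha : a ≠ 0) (hJ : dualIntegral f a ≠ ⊤)
    {ρ : ℝ} (h0 : 0 < ρ) (h1 : ρ < 1) : dualIntegral f (ρ • a) < dualIntegral f a := by
  have hm := measurable_dualFun f
  obtain ⟨η, hη, hball⟩ := exists_pos_le_dualFun hf he hone hpos hfin
  have habs : ∀ u : E n, |inner ℝ u (ρ • a)| ≤ |inner ℝ u a| := fun u => by
    rw [inner_smul_right, abs_mul, abs_of_pos h0]
    exact mul_le_of_le_one_left (abs_nonneg _) h1.le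
  have hle : ∀ u : E n, ENNReal.ofReal (Real.cosh (inner ℝ u (ρ • a))) * dualFun f u ≤
      ENNReal.ofReal (Real.cosh (inner ℝ u a)) * dualFun f u := fun u => by
    gcongr
    exact Real.cosh_le_cosh.2 (habs u)
  rw [dualIntegral_eq_cosh he] at hJ
  rw [dualIntegral_eq_cosh he, dualIntegral_eq_cosh he]
  refine lintegral_strict_mono_of_ae_le_of_ae_lt_on (s := Metric.ball 0 η) (by fun_prop)
    (ne_top_of_le_ne_top hJ (lintegral_mono hle)) (Eventually.of_forall hle)
    (Metric.measure_ball_pos _ _ hη).ne' ?_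
  filter_upwards [ae_inner_ne ha 0] with u hu hmem
  have hd := hball u (by simpa using hmem)
  rw [mul_comm, mul_comm _ (dualFun f u)]
  refine (ENNReal.mul_lt_mul_iff_right hd.ne'
    ((dualFun_le_one hone u).trans_lt ENNReal.one_lt_top).ne).2 ?_
  refine (ENNReal.ofReal_lt_ofReal_iff (Real.cosh_pos _)).2 (Real.cosh_lt_cosh.2 ?_)
  rw [inner_smul_right, abs_mul, abs_of_pos h0]
  exact mul_lt_of_lt_one_left (abs_pos.2 hu) h1

lemma dualIntegral_pos {n : ℕ} {f : E n → ℝ≥0} (hf : IsLogConcave f)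
    (he : IsEvenFun f) (hone : f 0 = 1) (hpos : 0 < ∫⁻ x, (f x : ℝ≥0∞))
    (hfin : ∫⁻ x, (f x : ℝ≥0∞) < ⊤) (a : E n) : 0 < dualIntegral f a := by
  have hm := measurable_dualFun f
  obtain ⟨η, hη, hball⟩ := exists_pos_le_dualFun hf he hone hpos hfin
  rw [dualIntegral, lintegral_pos_iff_support (by fun_prop)]
  refine (Metric.measure_ball_pos volume (0 : E n) hη).trans_le (measure_mono fun u hu => ?_)
  exact mul_ne_zero (by simpa using Real.exp_pos _) (hball u (by simpa using hu)).ne'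

/-- If `(f_a)°` is integrable, then `f` is positive at every `ρ a` with `0 < ρ < 1`. Otherwise a
vector `θ` separates `ρ a` from the support of `f`, and translating the argument of `(f_a)°` by
`-θ` multiplies it by at least a constant greater than `1`. -/
lemma apply_smul_pos_of_dualIntegral_ne_top {n : ℕ} {f : E n → ℝ≥0} (hf : IsLogConcave f)
    (he : IsEvenFun f) (hone : f 0 = 1) (hpos : 0 < ∫⁻ x, (f x : ℝ≥0∞))
    (hfin : ∫⁻ x, (f x : ℝ≥0∞) < ⊤) {a : E n} (hJ : dualIntegral f a ≠ ⊤)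
    {ρ : ℝ} (h0 : 0 < ρ) (h1 : ρ < 1) : 0 < f (ρ • a) := by
  by_contra hcon
  set C : Set (E n) := {x | 0 < f x} with hC
  have hconv : Convex ℝ C := hf.convex_lt 0
  have h0C : (0 : E n) ∈ interior C := by
    obtain ⟨r, hr, c, hc, hball⟩ := hf.exists_ball_le he hpos
    rw [mem_interior_iff_mem_nhds]
    exact mem_of_superset (Metric.ball_mem_nhds _ hr)
      fun x hx => hc.trans_le (hball x (by simpa using hx))
  obtain ⟨ℓ, hℓ⟩ := geometric_hahn_banach_open_point hconv.interior isOpen_interior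
    (fun h => hcon (show ρ • a ∈ C from interior_subset h))
  set θ : E n := (InnerProductSpace.toDual ℝ (E n)).symm ℓ with hθ
  have hℓθ : ∀ x, ℓ x = inner ℝ θ x := fun x =>
    (InnerProductSpace.toDual_symm_apply (𝕜 := ℝ) (E := E n)).symm
  set h : ℝ := inner ℝ θ (ρ • a) with hh
  have hhpos : 0 < h := by
    have := hℓ 0 h0C
    rwa [map_zero, hℓθ] at this
  have hsupp : ∀ z ∈ C, inner ℝ θ z ≤ h := by
    intro z hz
    have hlim : Tendsto (fun t : ℝ => t * inner ℝ θ z) (𝓝[<] 1) (𝓝 (1 * inner ℝ θ z)) :=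
      (tendsto_id'.2 nhdsWithin_le_nhds).mul_const _
    rw [one_mul] at hlim
    refine le_of_tendsto hlim ?_
    filter_upwards [Ioo_mem_nhdsLT zero_lt_one] with t ht
    have := hℓ _ (hconv.combo_self_interior_mem_interior hz h0C ht.1.le
      (sub_pos.2 ht.2) (by ring))
    rw [hℓθ, hℓθ, smul_zero, add_zero, inner_smul_right] at this
    exact this.le
  have hdual : ∀ u, ENNReal.ofReal (Real.exp (-h)) * dualFun f u ≤ dualFun f (u - θ) := by
    intro u
    unfold dualFun
    rw [ENNReal.mul_iInf_of_ne (by simpa using Real.exp_pos _) ENNReal.ofReal_ne_top]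
    refine iInf_mono fun y => ?_
    rcases eq_or_ne (f y) 0 with hy | hy
    · rw [hy, ENNReal.coe_zero, ENNReal.div_zero (by simpa using Real.exp_pos _),
        ENNReal.div_zero (by simpa using Real.exp_pos _)]
      exact le_top
    rw [← mul_div_assoc, ← ENNReal.ofReal_mul (Real.exp_pos _).le, ← Real.exp_add]
    gcongr
    have := hsupp (-y) (by rw [hC, mem_ofPred_eq, he]; exact pos_iff_ne_zero.2 hy)
    rw [inner_neg_right] at this
    rw [inner_sub_left]
    linarith
  set δ : ℝ := inner ℝ θ a - h with hδ
  have hδpos : 0 < δ := by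
    have : h = ρ * inner ℝ θ a := by rw [hh, inner_smul_right]
    rw [hδ]
    nlinarith
  have hkey : ENNReal.ofReal (Real.exp δ) * dualIntegral f a ≤ dualIntegral f a := by
    have hm := measurable_dualFun f
    calc ENNReal.ofReal (Real.exp δ) * dualIntegral f a
        = ∫⁻ u, ENNReal.ofReal (Real.exp δ) *
            (ENNReal.ofReal (Real.exp (-inner ℝ u a)) * dualFun f u) :=
          (lintegral_const_mul _ (by fun_prop)).symm
      _ ≤ ∫⁻ u, ENNReal.ofReal (Real.exp (-inner ℝ (u - θ) a)) * dualFun f (u - θ) := by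
          refine lintegral_mono fun u => ?_
          refine le_trans (le_of_eq ?_) (mul_le_mul_right (hdual u) _)
          rw [← mul_assoc, ← mul_assoc, ← ENNReal.ofReal_mul (Real.exp_pos _).le,
            ← ENNReal.ofReal_mul (Real.exp_pos _).le, ← Real.exp_add, ← Real.exp_add,
            inner_sub_left]
          congr 3
          rw [hδ]; ring
      _ = dualIntegral f a := lintegral_sub_right_eq_self
          (fun u => ENNReal.ofReal (Real.exp (-inner ℝ u a)) * dualFun f u) θ
  refine absurd hkey (not_le.2 ?_)
  conv_lhs => rw [← one_mul (dualIntegral f a)]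
  refine (ENNReal.mul_lt_mul_iff_left (dualIntegral_pos hf he hone hpos hfin a).ne' hJ).2 ?_
  rw [ENNReal.one_lt_ofReal]
  exact Real.one_lt_exp_iff.2 hδpos

/-- Besides being positive at `ρ a`, the function `f` is bounded below on a ball around it. -/
lemma exists_ball_le_of_dualIntegral_ne_top {n : ℕ} {f : E n → ℝ≥0} (hf : IsLogConcave f)
    (he : IsEvenFun f) (hone : f 0 = 1) (hpos : 0 < ∫⁻ x, (f x : ℝ≥0∞))
    (hfin : ∫⁻ x, (f x : ℝ≥0∞) < ⊤) {a : E n} (hJ : dualIntegral f a ≠ ⊤)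
    {ρ : ℝ} (h0 : 0 < ρ) (h1 : ρ < 1) :
    ∃ r > 0, ∃ c : ℝ≥0, 0 < c ∧ ∀ x, ‖x‖ < r → c ≤ f (ρ • a + x) := by
  obtain ⟨r, hr, c, hc, hball⟩ := hf.exists_ball_le he hpos
  -- `ρ a + x` is a convex combination of `σ a` with `σ = (1 + ρ) / 2` and a point near `0`.
  set σ : ℝ := (1 + ρ) / 2 with hσ
  have hσ0 : 0 < σ := by rw [hσ]; linarith
  have hσ1 : σ < 1 := by rw [hσ]; linarith
  have hpa := apply_smul_pos_of_dualIntegral_ne_top hf he hone hpos hfin hJ hσ0 hσ1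
  set t : ℝ := ρ / σ with ht
  have ht0 : 0 < t := by positivity
  have ht1 : 0 < 1 - t := by
    rw [sub_pos, ht, div_lt_one hσ0, hσ]; linarith
  refine ⟨(1 - t) * r, by positivity, min (f (σ • a)) c, lt_min hpa hc, fun x hx => ?_⟩
  have h := hf.min_le (σ • a) ((1 - t)⁻¹ • x) ht0.le (by linarith)
  have hxe : t • σ • a + (1 - t) • (1 - t)⁻¹ • x = ρ • a + x := by
    rw [smul_smul, smul_smul, mul_inv_cancel₀ ht1.ne', one_smul, ht, div_mul_cancel₀ _ hσ0.ne']
  rw [hxe] at h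
  refine (min_le_min le_rfl (hball _ ?_)).trans h
  rwa [norm_smul, norm_inv, Real.norm_of_nonneg ht1.le, inv_mul_lt_iff₀ ht1]


/-! ### The bodies attached to a log-concave function -/

lemma IsLogConcave.concaveOn_log {n : ℕ} {f : E n → ℝ≥0} (hf : IsLogConcave f) :
    ConcaveOn ℝ {x | 0 < f x} (fun x => Real.log (f x)) := by
  refine ⟨hf.convex_lt 0, fun x hx y hy a b ha hb hab => ?_⟩
  have hb' : b = 1 - a := by linarith
  subst hb'
  rcases ha.eq_or_lt with rfl | ha
  · simp
  rcases hb.eq_or_lt with h | hb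
  · have : a = 1 := by linarith
    simp [this]
  have hx' : (0 : ℝ) < f x := by exact_mod_cast hx
  have hy' : (0 : ℝ) < f y := by exact_mod_cast hy
  have h : ((f x : ℝ) ^ a * (f y : ℝ) ^ (1 - a)) ≤ f (a • x + (1 - a) • y) := by
    exact_mod_cast NNReal.coe_le_coe.2 (hf x y hx hy a ha (by linarith))
  have h2 := Real.log_le_log (by positivity) h
  rwa [Real.log_mul (by positivity) (by positivity), Real.log_rpow hx', Real.log_rpow hy'] at h2

/-- The domain `{f > e⁻ˢ}` of the profile of the body attached to `f`. -/
def logDomain {n : ℕ} (f : E n → ℝ≥0) (s : ℕ) : Set (E n) :=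
  {x | Real.exp (-s) < f x}

/-- The profile `1 + log f / s`, whose `s`-th power tends to `f`. -/
noncomputable def logProfile {n : ℕ} (f : E n → ℝ≥0) (s : ℕ) (x : E n) : ℝ :=
  1 + Real.log (f x) / s

/-- The body of revolution `closure {(x, y) : |y| ≤ 1 + log f(x) / s}` in `ℝⁿ × ℝˢ`. The closure
is taken because `f` need not be upper semicontinuous. -/
def logBody {n : ℕ} (f : E n → ℝ≥0) (s : ℕ) : Set (E (n + s)) :=
  closure (revSet s (logDomain f s) (logProfile f s))

lemma pos_of_mem_logDomain {n : ℕ} {f : E n → ℝ≥0} {s : ℕ} {x : E n} (hx : x ∈ logDomain f s) :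
    0 < f x := by
  have : (0 : ℝ) < f x := (Real.exp_pos _).trans hx
  exact_mod_cast this

lemma logProfile_pos {n : ℕ} {f : E n → ℝ≥0} {s : ℕ} (hs : 0 < s) {x : E n}
    (hx : x ∈ logDomain f s) : 0 < logProfile f s x := by
  have hs' : (0 : ℝ) < s := by exact_mod_cast hs
  have h : -(s : ℝ) < Real.log (f x) :=
    (Real.lt_log_iff_exp_lt (by exact_mod_cast pos_of_mem_logDomain hx)).2 hx
  have : -1 < Real.log (f x) / s := by
    rw [lt_div_iff₀ hs']; linarith
  unfold logProfile
  linarith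

lemma concaveOn_logProfile {n : ℕ} {f : E n → ℝ≥0} (hf : IsLogConcave f) (s : ℕ) :
    ConcaveOn ℝ (logDomain f s) (logProfile f s) := by
  have hconv : Convex ℝ (logDomain f s) := by
    have := hf.convex_lt (Real.exp (-s)).toNNReal
    convert this using 1
    ext x
    simp only [logDomain, mem_ofPred_eq]
    rw [← NNReal.coe_lt_coe, Real.coe_toNNReal _ (Real.exp_pos _).le]
  have h1 := (hf.concaveOn_log.subset (fun x hx => pos_of_mem_logDomain hx) hconv).smul
    (c := (s : ℝ)⁻¹) (by positivity)
  have h2 := (concaveOn_const (1 : ℝ) hconv).add h1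
  refine h2.congr fun x _ => ?_
  simp [logProfile, div_eq_inv_mul]

lemma logProfile_le_one {n : ℕ} {f : E n → ℝ≥0} (hle : ∀ x, f x ≤ 1) (s : ℕ) (x : E n) :
    logProfile f s x ≤ 1 := by
  have h : Real.log (f x) ≤ 0 := Real.log_nonpos (f x).2 (by exact_mod_cast hle x)
  have := div_nonpos_of_nonpos_of_nonneg h (Nat.cast_nonneg (α := ℝ) s)
  unfold logProfile
  linarith

lemma logProfile_pow_le {n : ℕ} {f : E n → ℝ≥0} {s : ℕ} (hs : 0 < s) {x : E n}
    (hx : x ∈ logDomain f s) : ENNReal.ofReal (logProfile f s x ^ s) ≤ f x := by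
  have hfx : (0 : ℝ) < f x := by exact_mod_cast pos_of_mem_logDomain hx
  rw [← ENNReal.ofReal_coe_nnreal]
  refine ENNReal.ofReal_le_ofReal ?_
  calc logProfile f s x ^ s ≤ Real.exp (Real.log (f x) / s) ^ s := by
        refine pow_le_pow_left₀ (logProfile_pos hs hx).le ?_ s
        unfold logProfile
        linarith [Real.add_one_le_exp (Real.log (f x) / s)]
    _ = f x := by
        rw [← Real.exp_nat_mul, mul_div_cancel₀ _ (by exact_mod_cast hs.ne'), Real.exp_log hfx]

lemma eventually_mem_logDomain {n : ℕ} {f : E n → ℝ≥0} {c : ℝ≥0} (hc : 0 < c) :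
    ∀ᶠ s : ℕ in atTop, ∀ x, c ≤ f x → x ∈ logDomain f s := by
  have h : Tendsto (fun s : ℕ => Real.exp (-(s : ℝ))) atTop (𝓝 0) :=
    Real.tendsto_exp_neg_atTop_nhds_zero.comp tendsto_natCast_atTop_atTop
  have hc' : (0 : ℝ) < c := by exact_mod_cast hc
  filter_upwards [h.eventually_lt_const hc'] with s hs x hx
  exact hs.trans_le (by exact_mod_cast hx)

lemma isCentrallySymmetric_logBody {n : ℕ} {f : E n → ℝ≥0} (he : IsEvenFun f) (s : ℕ) :
    IsCentrallySymmetric (logBody f s) := by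
  have h := neg_revSet (s := s) (D := logDomain f s) (φ := logProfile f s)
    (fun x hx => by simpa only [logDomain, mem_ofPred_eq, he x] using hx)
    (fun x => by simp only [logProfile, he x])
  unfold IsCentrallySymmetric logBody
  rw [neg_closure, ← h]

lemma eventually_isConvexBody_logBody {n : ℕ} {f : E n → ℝ≥0} (hf : IsLogConcave f)
    (he : IsEvenFun f) (hone : f 0 = 1) (hpos : 0 < ∫⁻ x, (f x : ℝ≥0∞))
    (hfin : ∫⁻ x, (f x : ℝ≥0∞) < ⊤) :
    ∀ᶠ s : ℕ in atTop, IsConvexBody (logBody f s) := by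
  obtain ⟨r, hr, c, hc, hball⟩ := hf.exists_ball_le he hpos
  filter_upwards [eventually_mem_logDomain (f := fun _ : E n => c) hc, eventually_mem_logDomain hc,
    eventually_gt_atTop 0] with s hs' hs hs0
  have hexp : 0 < (Real.exp (-s)).toNNReal := Real.toNNReal_pos.2 (Real.exp_pos _)
  obtain ⟨R, hR, hRb⟩ := hf.exists_norm_le he hpos hfin hexp
  refine isConvexBody_closure_revSet (concaveOn_logProfile hf s) (R := R) (fun x hx => ?_)
    (fun x _ => logProfile_le_one (fun x => hone ▸ hf.le_apply_zero he x) s x) hr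
    (logProfile_pos (f := fun _ : E n => c) hs0 (hs' 0 le_rfl))
    (fun x hx => ⟨hs x (hball x hx), ?_⟩)
  · refine hRb x ?_
    rw [← NNReal.coe_le_coe, Real.coe_toNNReal _ (Real.exp_pos _).le]
    exact hx.le
  · unfold logProfile
    gcongr
    exact hball x hx

lemma volume_logBody_inter_le {n : ℕ} {f : E n → ℝ≥0} (hf : IsLogConcave f) {s : ℕ} (hs : 0 < s)
    {T : Set (E n)} (hT : MeasurableSet T) :
    volume ({z | (splitCoord n s z).1 ∈ T} ∩ logBody f s) ≤
      unitBallVol s * ∫⁻ x in T, (f x : ℝ≥0∞) :=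
  volume_closure_revSet_inter_le (concaveOn_logProfile hf s)
    (fun _ hx => (logProfile_pos hs hx).le) (fun _ hx => logProfile_pow_le hs hx) hT

lemma tendsto_logProfile_pow {n : ℕ} {f : E n → ℝ≥0} {x : E n} (hx : 0 < f x) :
    Tendsto (fun s : ℕ => logProfile f s x ^ s) atTop (𝓝 (f x : ℝ)) := by
  have h := Real.tendsto_one_add_div_pow_exp (Real.log (f x))
  rwa [Real.exp_log (by exact_mod_cast hx)] at h

lemma le_liminf_volume_logBody {n : ℕ} (f : E n → ℝ≥0) :
    ∫⁻ x, (f x : ℝ≥0∞) ≤ liminf (fun s : ℕ => volume (logBody f s) / unitBallVol s) atTop := by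
  have hK : ∀ s, MeasurableSet (logBody f s) := fun s => isClosed_closure.measurableSet
  have hint : ∀ s : ℕ, ∫⁻ x, sectionVol (logBody f s) x / unitBallVol s =
      volume (logBody f s) / unitBallVol s := fun s => by
    simp only [div_eq_mul_inv]
    rw [lintegral_mul_const' _ _ (ENNReal.inv_ne_top.2 (unitBallVol_ne_zero s)),
      volume_eq_lintegral_sectionVol (hK s)]
  simp_rw [← hint]
  refine le_trans ?_ (lintegral_liminf_le fun s => (measurable_sectionVol (hK s)).div_const _)
  refine lintegral_mono fun x => ?_
  rcases eq_or_ne (f x) 0 with h0 | h0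
  · simp [h0]
  have hx : 0 < f x := pos_iff_ne_zero.2 h0
  have ht := (ENNReal.continuous_ofReal.tendsto _).comp (tendsto_logProfile_pow hx)
  rw [ENNReal.ofReal_coe_nnreal] at ht
  refine ht.liminf_eq.symm.le.trans (liminf_le_liminf ?_)
  filter_upwards [eventually_mem_logDomain hx, eventually_gt_atTop 0] with s hs hs0
  rw [ENNReal.le_div_iff_mul_le (Or.inl (unitBallVol_ne_zero s)) (Or.inl (unitBallVol_ne_top s)),
    mul_comm]
  exact le_sectionVol_closure_revSet (hs x le_rfl) (logProfile_pos hs0 (hs x le_rfl)).le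

/-! ### The polar bodies as `s → ∞` -/

lemma tendsto_max_one_sub_div_pow (t : ℝ) :
    Tendsto (fun s : ℕ => max 0 (1 - t / s) ^ s) atTop (𝓝 (Real.exp (-t))) := by
  refine (Real.tendsto_one_add_div_pow_exp (-t)).congr' ?_
  obtain ⟨N, hN⟩ := exists_nat_gt t
  filter_upwards [eventually_ge_atTop N, eventually_gt_atTop 0] with s hs hs0
  have hs0' : (0 : ℝ) < s := by exact_mod_cast hs0
  have : t / s ≤ 1 := (div_le_one hs0').2 (hN.le.trans (by exact_mod_cast hs))
  rw [max_eq_right (by linarith), neg_div, ← sub_eq_add_neg]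

lemma max_one_sub_div_pow_le {s : ℕ} (hs : 0 < s) (t : ℝ) :
    max 0 (1 - t / s) ^ s ≤ Real.exp (-t) := by
  have hs' : (s : ℝ) ≠ 0 := by exact_mod_cast hs.ne'
  calc max 0 (1 - t / s) ^ s ≤ Real.exp (-(t / s)) ^ s := by
        refine pow_le_pow_left₀ (le_max_left _ _) (max_le (Real.exp_pos _).le ?_) s
        linarith [Real.add_one_le_exp (-(t / s))]
    _ = Real.exp (-t) := by
        rw [← Real.exp_nat_mul]
        congr 1
        field_simp

lemma lintegral_exp_neg_norm_lt_top (n : ℕ) {r : ℝ} (hr : 0 < r) :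
    ∫⁻ u : E n, ENNReal.ofReal (Real.exp (-(r * ‖u‖))) < ⊤ := by
  have h := finite_integral_one_add_norm (E := E n) (μ := volume) (r := (n + 1 : ℕ))
    (by rw [finrank_euclideanSpace_fin]; exact_mod_cast Nat.lt_succ_self n)
  set C : ℝ := (n + 1).factorial * Real.exp r / r ^ (n + 1) with hC
  have hC0 : 0 ≤ C := by positivity
  calc _ ≤ ∫⁻ u : E n, ENNReal.ofReal C * ENNReal.ofReal ((1 + ‖u‖) ^ (-((n + 1 : ℕ) : ℝ))) := by
        refine lintegral_mono fun u => ?_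
        rw [← ENNReal.ofReal_mul hC0]
        refine ENNReal.ofReal_le_ofReal ?_
        have h1 := Real.pow_div_factorial_le_exp (r * (1 + ‖u‖)) (by positivity) (n + 1)
        have h2 : (0 : ℝ) < 1 + ‖u‖ := by positivity
        rw [Real.rpow_neg h2.le, Real.rpow_natCast, hC, Real.exp_neg, ← div_eq_mul_inv, div_div,
          inv_eq_one_div, div_le_div_iff₀ (Real.exp_pos _) (by positivity), one_mul, mul_assoc,
          ← Real.exp_add, ← mul_pow]
        rw [div_le_iff₀ (by positivity)] at h1
        calc _ = (r * (1 + ‖u‖)) ^ (n + 1) := by ring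
          _ ≤ _ := h1
          _ = _ := by rw [mul_comm, mul_one_add]
    _ < ⊤ := by
        rw [lintegral_const_mul' _ _ ENNReal.ofReal_ne_top]
        exact ENNReal.mul_lt_top ENNReal.ofReal_lt_top h

/-- The radial bound for the fibres of the polar body, after rescaling by `1 / s`. -/
lemma sectionVol_recentredPolar_logBody_le {n s : ℕ} {f : E n → ℝ≥0} (hs : 0 < s) {x : E n}
    (hx : x ∈ logDomain f s) (b u : E n) :
    sectionVol (recentredPolar (logBody f s) ((splitCoord n s).symm (b, 0))) ((s : ℝ)⁻¹ • u) /
      unitBallVol s ≤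
      ENNReal.ofReal (max 0 (1 - inner ℝ u (x - b) / s) ^ s / logProfile f s x ^ s) := by
  refine ENNReal.div_le_of_le_mul' ?_
  have h := sectionVol_recentredPolar_le (s := s) hx (logProfile_pos hs hx) b ((s : ℝ)⁻¹ • u)
  rw [real_inner_smul_left, ← div_eq_inv_mul, div_pow] at h
  exact h

/-- With `κₛ` the volume of the unit ball of `ℝˢ` and `Kₛ` the body attached to `f`, the limit
superior of `sⁿ Vol(Kₛ^{(b,0)}) / κₛ` is at most `∫ (f_b)°`: the fibres of the rescaled polar
bodies are dominated by a multiple of `e^{-r|u|}` as soon as `f` is bounded below near `b`. -/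
lemma limsup_volume_recentredPolar_le {n : ℕ} {f : E n → ℝ≥0} (he : IsEvenFun f) {b : E n}
    {r : ℝ} (hr : 0 < r) {c : ℝ≥0} (hc : 0 < c) (hball : ∀ x, ‖x‖ < r → c ≤ f (b + x)) :
    limsup (fun s : ℕ => ENNReal.ofReal ((s : ℝ) ^ n) *
      volume (recentredPolar (logBody f s) ((splitCoord n s).symm (b, 0))) / unitBallVol s) atTop ≤
      dualIntegral f b := by
  set P : (s : ℕ) → Set (E (n + s)) := fun s =>
    recentredPolar (logBody f s) ((splitCoord n s).symm (b, 0)) with hP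
  have hPm : ∀ s, MeasurableSet (P s) := fun s => measurableSet_recentredPolar _ _
  set q : ℕ → E n → ℝ≥0∞ := fun s u => sectionVol (P s) ((s : ℝ)⁻¹ • u) / unitBallVol s with hq
  have hqm : ∀ s, Measurable (q s) := fun s =>
    ((measurable_sectionVol (hPm s)).comp (measurable_const_smul _)).div_const _
  have hint : ∀ᶠ s : ℕ in atTop, ENNReal.ofReal ((s : ℝ) ^ n) * volume (P s) / unitBallVol s =
      ∫⁻ u, q s u := by
    filter_upwards [eventually_gt_atTop 0] with s hs
    simp only [hq, div_eq_mul_inv]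
    rw [lintegral_mul_const' _ _ (ENNReal.inv_ne_top.2 (unitBallVol_ne_zero s)),
      lintegral_comp_inv_smul (measurable_sectionVol (hPm s)) (by exact_mod_cast hs),
      ← volume_eq_lintegral_sectionVol (hPm s)]
  rw [limsup_congr hint]
  have hlim : ∀ u, limsup (fun s => q s u) atTop ≤
      ENNReal.ofReal (Real.exp (inner ℝ u b)) * dualFun f u := by
    intro u
    unfold dualFun
    rw [ENNReal.mul_iInf_of_ne (by simpa using Real.exp_pos _) ENNReal.ofReal_ne_top]
    refine le_iInf fun x => ?_
    rcases eq_or_ne (f x) 0 with h0 | h0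
    · rw [h0, ENNReal.coe_zero, ENNReal.div_zero (by simpa using Real.exp_pos _),
        ENNReal.mul_top (by simpa using Real.exp_pos _)]
      exact le_top
    have hx : 0 < f x := pos_iff_ne_zero.2 h0
    have hx' : (0 : ℝ) < f x := by exact_mod_cast hx
    have ht := (ENNReal.continuous_ofReal.tendsto _).comp
      ((tendsto_max_one_sub_div_pow (inner ℝ u (x - b))).div (tendsto_logProfile_pow hx) hx'.ne')
    have hv : ENNReal.ofReal (Real.exp (-inner ℝ u (x - b)) / f x) =
        ENNReal.ofReal (Real.exp (inner ℝ u b)) *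
          (ENNReal.ofReal (Real.exp (-inner ℝ u x)) / f x) := by
      rw [← mul_div_assoc, ← ENNReal.ofReal_mul (Real.exp_pos _).le, ← Real.exp_add,
        ENNReal.ofReal_div_of_pos hx', ENNReal.ofReal_coe_nnreal, inner_sub_right]
      congr 3
      ring
    rw [← hv]
    refine le_trans (limsup_le_limsup ?_) ht.limsup_eq.le
    filter_upwards [eventually_mem_logDomain hx, eventually_gt_atTop 0] with s hs hs0
    exact sectionVol_recentredPolar_logBody_le hs0 (hs x le_rfl) b u
  have hc' : (0 : ℝ) < c := by exact_mod_cast hc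
  have hev : ∀ᶠ s : ℕ in atTop, ∀ u, q s u ≤
      ENNReal.ofReal (2 / c) * ENNReal.ofReal (Real.exp (-(r / 2 * ‖u‖))) := by
    have h1 := tendsto_logProfile_pow (f := fun _ : E n => c) (x := 0) hc
    filter_upwards [h1.eventually_const_lt (half_lt_self hc'), eventually_mem_logDomain hc,
      eventually_mem_logDomain (f := fun _ : E n => c) hc,
      eventually_gt_atTop 0] with s hs1 hs2 hs2' hs0 u
    -- The bound comes from the point of the sphere of radius `r / 2` about `b` in direction `u`.
    obtain ⟨v, hv1, hv2⟩ : ∃ v : E n, ‖v‖ < r ∧ inner ℝ u v = r / 2 * ‖u‖ := by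
      by_cases h0 : u = 0
      · exact ⟨0, by simpa using hr, by simp [h0]⟩
      · have hu : ‖u‖ ≠ 0 := norm_ne_zero_iff.2 h0
        refine ⟨(r / 2 * ‖u‖⁻¹) • u, ?_, ?_⟩
        · rw [norm_smul, norm_mul, norm_inv, norm_norm, mul_assoc, inv_mul_cancel₀ hu,
            Real.norm_of_nonneg (by positivity)]
          linarith
        · rw [inner_smul_right, real_inner_self_eq_norm_sq]
          field_simp
    have hx := hs2 _ (hball v hv1)
    refine (sectionVol_recentredPolar_logBody_le hs0 hx b u).trans ?_
    rw [← ENNReal.ofReal_mul (by positivity), add_sub_cancel_left, hv2]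
    refine ENNReal.ofReal_le_ofReal ?_
    have hprof : (c : ℝ) / 2 ≤ logProfile f s (b + v) ^ s := by
      refine hs1.le.trans (pow_le_pow_left₀ (logProfile_pos hs0 (hs2' 0 le_rfl)).le ?_ s)
      unfold logProfile
      gcongr
      exact hball v hv1
    calc _ ≤ Real.exp (-(r / 2 * ‖u‖)) / (c / 2) := by
          gcongr
          exact max_one_sub_div_pow_le hs0 _
      _ = _ := by field_simp
  obtain ⟨N, hN⟩ := eventually_atTop.1 hev
  rw [← limsup_nat_add _ N, dualIntegral_eq_exp_pos he]
  refine (limsup_lintegral_le _ (fun s => hqm (s + N))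
    (fun s => Eventually.of_forall (hN (s + N) (Nat.le_add_left _ _))) ?_).trans ?_
  · rw [lintegral_const_mul' _ _ ENNReal.ofReal_ne_top]
    exact ENNReal.mul_ne_top ENNReal.ofReal_ne_top
      (lintegral_exp_neg_norm_lt_top n (by positivity)).ne
  · refine lintegral_mono fun u => ?_
    rw [limsup_nat_add (fun s => q s u) N]
    exact hlim u


/-! ### From bodies to functions -/

/-- The strict inequality `∫ f ∫ (f_b)° < (2π)ⁿ d` puts `(b, 0)` into the Santaló regions of the
bodies attached to `f`, for all large `s`. -/
lemma eventually_mem_santaloBody {n : ℕ} {f : E n → ℝ≥0} (hf : IsLogConcave f)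
    (he : IsEvenFun f) (hpos : 0 < ∫⁻ x, (f x : ℝ≥0∞))
    (hfin : ∫⁻ x, (f x : ℝ≥0∞) < ⊤) {d : ℝ} {b : E n} {r : ℝ} (hr : 0 < r) {c : ℝ≥0} (hc : 0 < c)
    (hball : ∀ x, ‖x‖ < r → c ≤ f (b + x))
    (hlt : (∫⁻ x, (f x : ℝ≥0∞)) * dualIntegral f b < ENNReal.ofReal ((2 * Real.pi) ^ n * d)) :
    ∀ᶠ s : ℕ in atTop, (splitCoord n s).symm (b, 0) ∈ santaloBody (logBody f s) d := by
  set I := ∫⁻ x, (f x : ℝ≥0∞) with hI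
  set G := ENNReal.ofReal (√(2 * Real.pi) ^ n) with hG
  have hG0 : 0 < G := by rw [hG, ENNReal.ofReal_pos]; positivity
  have hGd : ENNReal.ofReal ((2 * Real.pi) ^ n * d) = ENNReal.ofReal d * G ^ 2 := by
    rw [hG, ← ENNReal.ofReal_pow (by positivity), mul_comm, ← pow_mul, mul_comm n 2, pow_mul,
      Real.sq_sqrt (by positivity), ENNReal.ofReal_mul' (by positivity)]
  rw [hGd] at hlt
  obtain ⟨m, hm1, hm2⟩ := exists_between hlt
  have hball_ev : ∀ᶠ s : ℕ in atTop, m <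
      ENNReal.ofReal d * (ENNReal.ofReal (√s ^ n) * unitBallVol (n + s) / unitBallVol s) ^ 2 := by
    have hcont : Continuous fun B : ℝ≥0∞ => ENNReal.ofReal d * B ^ 2 :=
      (ENNReal.continuous_const_mul ENNReal.ofReal_ne_top).comp (ENNReal.continuous_pow 2)
    obtain ⟨l, hl, hsub⟩ := exists_Ioc_subset_of_mem_nhds
      (hcont.continuousAt.eventually_const_lt hm2 : {B | m < ENNReal.ofReal d * B ^ 2} ∈ 𝓝 G)
      ⟨0, hG0⟩
    obtain ⟨g, hg1, hg2⟩ := exists_between hl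
    have hg : m < ENNReal.ofReal d * g ^ 2 := hsub ⟨hg1, hg2.le⟩
    filter_upwards [eventually_lt_of_lt_liminf (hg2.trans_le (le_liminf_volume_ball n))] with s hs
    refine hg.trans_le ?_
    gcongr
  have hpol : ∀ᶠ s : ℕ in atTop, I * (ENNReal.ofReal ((s : ℝ) ^ n) *
      volume (recentredPolar (logBody f s) ((splitCoord n s).symm (b, 0))) / unitBallVol s) ≤ m := by
    have hJ : dualIntegral f b < m / I := by
      rw [ENNReal.lt_div_iff_mul_lt (Or.inl hpos.ne') (Or.inl hfin.ne), mul_comm]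
      exact hm1
    filter_upwards [eventually_lt_of_limsup_lt
      ((limsup_volume_recentredPolar_le he hr hc hball).trans_lt hJ)] with s hs
    exact (mul_le_mul_right hs.le I).trans ENNReal.mul_div_le
  have hfb : 0 < f b := hc.trans_le (by simpa using hball 0 (by simpa using hr))
  filter_upwards [hball_ev, hpol, eventually_mem_logDomain hfb, eventually_gt_atTop 0]
    with s hB hP hD hs
  refine ⟨subset_closure ⟨by simpa using hD b le_rfl, ?_⟩, ?_⟩
  · simpa using (logProfile_pos hs (hD b le_rfl)).le
  rw [volume_polarAt]
  set V := volume (recentredPolar (logBody f s) ((splitCoord n s).symm (b, 0))) with hV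
  set κ := unitBallVol s with hκ
  have hκ0 : κ ≠ 0 := unitBallVol_ne_zero s
  have hκt : κ ≠ ⊤ := unitBallVol_ne_top s
  have hs' : (0 : ℝ) < s := by exact_mod_cast hs
  set S := ENNReal.ofReal ((s : ℝ) ^ n) with hS
  have hS0 : S ≠ 0 := (ENNReal.ofReal_pos.2 (pow_pos hs' n)).ne'
  have hSt : S ≠ ⊤ := ENNReal.ofReal_ne_top
  have hSq : ENNReal.ofReal (√s ^ n) ^ 2 = S := by
    rw [← ENNReal.ofReal_pow (by positivity), ← pow_mul, mul_comm n 2, pow_mul,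
      Real.sq_sqrt hs'.le]
  have hK : volume (logBody f s) ≤ κ * I := by
    have := volume_logBody_inter_le hf hs (T := univ) MeasurableSet.univ
    simpa using this
  have hmain : I * (S * V / κ) ≤ ENNReal.ofReal d * (S * unitBallVol (n + s) ^ 2 / κ ^ 2) := by
    refine hP.trans (hB.le.trans (le_of_eq ?_))
    rw [div_eq_mul_inv, mul_pow, mul_pow, hSq, ← ENNReal.inv_pow, div_eq_mul_inv]
  have hinv : κ * κ⁻¹ = 1 := ENNReal.mul_inv_cancel hκ0 hκt
  have hSinv : S * S⁻¹ = 1 := ENNReal.mul_inv_cancel hS0 hSt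
  calc volume (logBody f s) * V ≤ κ * I * V := by gcongr
    _ = (κ ^ 2 * S⁻¹) * (I * (S * V / κ)) := by
        rw [div_eq_mul_inv]
        calc κ * I * V = κ * I * V * (κ * κ⁻¹) * (S * S⁻¹) := by rw [hinv, hSinv]; ring
          _ = _ := by ring
    _ ≤ (κ ^ 2 * S⁻¹) * (ENNReal.ofReal d * (S * unitBallVol (n + s) ^ 2 / κ ^ 2)) := by gcongr
    _ = ENNReal.ofReal d * unitBallVol (n + s) ^ 2 * (κ * κ⁻¹) ^ 2 * (S * S⁻¹) := by
        rw [div_eq_mul_inv, ENNReal.inv_pow]; ring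
    _ = _ := by rw [hinv, hSinv]; ring

/-- Under the inclusion for bodies of revolution, a point with the strict inequality
`∫ f ∫ (f_b)° < (2π)ⁿ d` lies on the correct side of every hyperplane cutting off the fraction
`lam` of the integral. -/
lemma inner_le_of_dualIntegral_lt {n : ℕ} {lam d : ℝ} (hlam : 0 < lam) (hlam' : lam < 1 / 2)
    (hyp : ∀ (s : ℕ) (K : Set (E (n + s))), 1 ≤ s → IsConvexBody K → IsCentrallySymmetric K →
      IsRevolution K → santaloBody K d ⊆ floatingBody K lam)
    {f : E n → ℝ≥0} (hf : IsLogConcave f) (he : IsEvenFun f) (hone : f 0 = 1)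
    (hpos : 0 < ∫⁻ x, (f x : ℝ≥0∞)) (hfin : ∫⁻ x, (f x : ℝ≥0∞) < ⊤)
    {b : E n} {r : ℝ} (hr : 0 < r) {c : ℝ≥0} (hc : 0 < c)
    (hball : ∀ x, ‖x‖ < r → c ≤ f (b + x))
    (hlt : (∫⁻ x, (f x : ℝ≥0∞)) * dualIntegral f b < ENNReal.ofReal ((2 * Real.pi) ^ n * d))
    {θ : E n} (hθ : ‖θ‖ = 1) {α : ℝ}
    (hα : ∫⁻ x in upperHalfSpace θ α, (f x : ℝ≥0∞) =
      ENNReal.ofReal lam * ∫⁻ x, (f x : ℝ≥0∞)) : inner ℝ b θ ≤ α := by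
  set β : ℝ := inner ℝ b θ with hβ
  have hl0 : ENNReal.ofReal lam ≠ 0 := by simpa using hlam
  have hev : ∀ᶠ s : ℕ in atTop, volume (logBody f s) / unitBallVol s ≤
      (∫⁻ x in upperHalfSpace θ β, (f x : ℝ≥0∞)) / ENNReal.ofReal lam := by
    filter_upwards [eventually_mem_santaloBody hf he hpos hfin hr hc hball hlt,
      eventually_isConvexBody_logBody hf he hone hpos hfin, eventually_gt_atTop 0] with s hS hK hs
    have hF := hyp s _ hs hK (isCentrallySymmetric_logBody he s)
      (isRevolution_closure_revSet _ _) hS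
    have hθ' : ‖(splitCoord n s).symm (θ, 0)‖ = 1 := by
      have := norm_sq_eq_add_splitCoord ((splitCoord n s).symm (θ, (0 : E s)))
      simp only [ContinuousLinearEquiv.apply_symm_apply, hθ, norm_zero] at this
      exact (pow_eq_one_iff_of_nonneg (norm_nonneg _) two_ne_zero).1 (by rw [this]; norm_num)
    have h1 := volume_le_of_mem_floatingBody hK.1 hlam.le (by linarith) hF hθ'
    have hset : upperHalfSpace ((splitCoord n s).symm (θ, (0 : E s)))
        (inner ℝ ((splitCoord n s).symm (b, (0 : E s))) ((splitCoord n s).symm (θ, 0))) =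
        {z | (splitCoord n s z).1 ∈ upperHalfSpace θ β} := by
      ext z
      simp [upperHalfSpace, inner_eq_add_inner_splitCoord, hβ]
    rw [hset] at h1
    have h2 := h1.trans (volume_logBody_inter_le hf hs (measurableSet_upperHalfSpace θ β))
    rw [ENNReal.le_div_iff_mul_le (Or.inl hl0) (Or.inl ENNReal.ofReal_ne_top), mul_comm,
      ← mul_div_assoc]
    exact ENNReal.div_le_of_le_mul' h2
  have hcut : ENNReal.ofReal lam * ∫⁻ x, (f x : ℝ≥0∞) ≤
      ∫⁻ x in upperHalfSpace θ β, (f x : ℝ≥0∞) := by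
    have h := (le_liminf_volume_logBody f).trans (liminf_le_of_frequently_le' hev.frequently)
    rw [ENNReal.le_div_iff_mul_le (Or.inl hl0) (Or.inl ENNReal.ofReal_ne_top), mul_comm] at h
    exact h
  -- Otherwise the slab between the two hyperplanes carries no mass, although it meets every
  -- neighbourhood of `b`.
  by_contra! hcon
  have hsplit : ∫⁻ x in upperHalfSpace θ α, (f x : ℝ≥0∞) =
      (∫⁻ x in upperHalfSpace θ β, (f x : ℝ≥0∞)) +
      ∫⁻ x in upperHalfSpace θ α \ upperHalfSpace θ β, (f x : ℝ≥0∞) := by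
    have hinter : upperHalfSpace θ α ∩ upperHalfSpace θ β = upperHalfSpace θ β :=
      inter_eq_right.2 fun x hx => hcon.le.trans hx
    rw [← lintegral_inter_add_sdiff _ (upperHalfSpace θ α) (measurableSet_upperHalfSpace θ β),
      hinter]
  set τ : ℝ := min r (β - α) / 2 with hτ
  have hτ0 : 0 < τ := by
    have := lt_min hr (sub_pos.2 hcon)
    positivity
  have hτr : 2 * τ ≤ r := by rw [hτ]; linarith [min_le_left r (β - α)]
  have hτα : 2 * τ ≤ β - α := by rw [hτ]; linarith [min_le_right r (β - α)]
  have hslab : (c : ℝ≥0∞) * volume (Metric.ball (b - τ • θ) τ) ≤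
      ∫⁻ x in upperHalfSpace θ α \ upperHalfSpace θ β, (f x : ℝ≥0∞) := by
    rw [← setLIntegral_const]
    have hin : ∀ x ∈ Metric.ball (b - τ • θ) τ, |inner ℝ x θ - (β - τ)| < τ := by
      intro x hx
      rw [Metric.mem_ball, dist_eq_norm] at hx
      have h1 : inner ℝ x θ - (β - τ) = inner ℝ (x - (b - τ • θ)) θ := by
        rw [inner_sub_left, inner_sub_left, real_inner_smul_left, real_inner_self_eq_norm_sq, hθ,
          hβ]
        ring
      rw [h1]
      exact (abs_real_inner_le_norm _ _).trans_lt (by rwa [hθ, mul_one])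
    have hsub : Metric.ball (b - τ • θ) τ ⊆ upperHalfSpace θ α \ upperHalfSpace θ β := by
      intro x hx
      have h := abs_lt.1 (hin x hx)
      refine ⟨?_, ?_⟩
      · change α ≤ inner ℝ x θ
        linarith [h.1]
      · change ¬ β ≤ inner ℝ x θ
        linarith [h.2]
    refine (setLIntegral_mono' measurableSet_ball fun x hx => ?_).trans (lintegral_mono_set hsub)
    have hxr : ‖x - b‖ < r := by
      rw [Metric.mem_ball, dist_eq_norm] at hx
      calc ‖x - b‖ = ‖(x - (b - τ • θ)) - τ • θ‖ := by congr 1; abel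
        _ ≤ ‖x - (b - τ • θ)‖ + ‖τ • θ‖ := norm_sub_le _ _
        _ < τ + τ := by
          rw [norm_smul, hθ, mul_one, Real.norm_of_nonneg hτ0.le]
          linarith
        _ ≤ r := by linarith
    have := hball _ hxr
    rw [add_sub_cancel] at this
    exact_mod_cast this
  have hslab0 : 0 < ∫⁻ x in upperHalfSpace θ α \ upperHalfSpace θ β, (f x : ℝ≥0∞) :=
    lt_of_lt_of_le (ENNReal.mul_pos (by simpa using hc.ne')
      (Metric.measure_ball_pos _ _ hτ0).ne') hslab
  have hfinβ : ∫⁻ x in upperHalfSpace θ β, (f x : ℝ≥0∞) ≠ ⊤ :=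
    ((setLIntegral_le_lintegral _ _).trans_lt hfin).ne
  have h := ENNReal.lt_add_right hfinβ hslab0.ne'
  rw [← hsplit, hα] at h
  exact absurd hcut (not_le.2 h)

/-- As `f` is even, a half-space cutting off less than half of the integral does not contain the
origin in its interior. -/
lemma nonneg_of_setLIntegral_eq {n : ℕ} {lam : ℝ} (hlam' : lam < 1 / 2)
    {f : E n → ℝ≥0} (he : IsEvenFun f)
    (hpos : 0 < ∫⁻ x, (f x : ℝ≥0∞)) (hfin : ∫⁻ x, (f x : ℝ≥0∞) < ⊤) {θ : E n} {α : ℝ}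
    (hα : ∫⁻ x in upperHalfSpace θ α, (f x : ℝ≥0∞) =
      ENNReal.ofReal lam * ∫⁻ x, (f x : ℝ≥0∞)) : 0 ≤ α := by
  by_contra! hneg
  have hrefl : ∫⁻ x in (fun x : E n => -x) ⁻¹' upperHalfSpace θ 0, (f x : ℝ≥0∞) =
      ∫⁻ x in upperHalfSpace θ 0, (f x : ℝ≥0∞) := by
    have h := (Measure.measurePreserving_neg (volume : Measure (E n))).setLIntegral_comp_preimage_emb
      (MeasurableEquiv.neg (E n)).measurableEmbedding (fun x => (f x : ℝ≥0∞)) (upperHalfSpace θ 0)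
    simp only [he _] at h
    exact h
  have hcover : (fun x : E n => -x) ⁻¹' upperHalfSpace θ 0 ∪ upperHalfSpace θ 0 = univ := by
    refine eq_univ_of_forall fun x => ?_
    rcases le_total 0 (inner ℝ x θ : ℝ) with h | h
    · exact Or.inr h
    · refine Or.inl ?_
      change (0 : ℝ) ≤ inner ℝ (-x) θ
      rw [inner_neg_left]
      linarith
  have hle : ∫⁻ x in upperHalfSpace θ 0, (f x : ℝ≥0∞) ≤
      ENNReal.ofReal lam * ∫⁻ x, (f x : ℝ≥0∞) := by
    rw [← hα]
    exact lintegral_mono_set fun x hx => hneg.le.trans hx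
  have h2 : 1 * ∫⁻ x, (f x : ℝ≥0∞) ≤ (2 * ENNReal.ofReal lam) * ∫⁻ x, (f x : ℝ≥0∞) := by
    calc 1 * ∫⁻ x, (f x : ℝ≥0∞) = ∫⁻ x in (fun x : E n => -x) ⁻¹' upperHalfSpace θ 0 ∪
          upperHalfSpace θ 0, (f x : ℝ≥0∞) := by rw [hcover, setLIntegral_univ, one_mul]
      _ ≤ _ := lintegral_union_le _ _ _
      _ ≤ _ := by rw [hrefl, ← two_mul, mul_assoc]; gcongr
  rw [ENNReal.mul_le_mul_iff_left hpos.ne' hfin.ne, ← ENNReal.ofReal_ofNat 2,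
    ← ENNReal.ofReal_mul (by norm_num), ENNReal.one_le_ofReal] at h2
  linarith

lemma lintegral_translate {n : ℕ} (f : E n → ℝ≥0) (a : E n) :
    ∫⁻ x, (translate f a x : ℝ≥0∞) = ∫⁻ x, (f x : ℝ≥0∞) :=
  lintegral_sub_right_eq_self (fun x => (f x : ℝ≥0∞)) a

/-- The inclusion for functions normalized by `f 0 = 1`: the points `ρ a` with `ρ < 1` satisfy the
strict inequality, and `ρ → 1`. -/
lemma santaloFun_subset_floatingFun_of_apply_zero {n : ℕ} {lam d : ℝ} (hlam : 0 < lam)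
    (hlam' : lam < 1 / 2)
    (hyp : ∀ (s : ℕ) (K : Set (E (n + s))), 1 ≤ s → IsConvexBody K → IsCentrallySymmetric K →
      IsRevolution K → santaloBody K d ⊆ floatingBody K lam)
    {f : E n → ℝ≥0} (hf : IsLogConcave f) (he : IsEvenFun f) (hone : f 0 = 1)
    (hpos : 0 < ∫⁻ x, (f x : ℝ≥0∞)) (hfin : ∫⁻ x, (f x : ℝ≥0∞) < ⊤) :
    santaloFun f d ⊆ floatingFun f lam := by
  intro a ha
  simp only [santaloFun, mem_ofPred_eq, lintegral_translate, lintegral_dualFun_translate] at ha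
  simp only [floatingFun, mem_iInter]
  intro θ hθ α hα
  have hθ1 : ‖θ‖ = 1 := by simpa using hθ
  change inner ℝ a θ ≤ α
  rcases eq_or_ne a 0 with rfl | ha0
  · rw [inner_zero_left]
    exact nonneg_of_setLIntegral_eq hlam' he hpos hfin hα
  have hJ : dualIntegral f a ≠ ⊤ := fun h => by
    rw [h, ENNReal.mul_top hpos.ne'] at ha
    exact absurd ha (not_le.2 ENNReal.ofReal_lt_top)
  have hlim : Tendsto (fun ρ : ℝ => inner ℝ (ρ • a) θ) (𝓝[<] 1) (𝓝 (inner ℝ ((1 : ℝ) • a) θ)) :=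
    ((by fun_prop : Continuous fun ρ : ℝ => (inner ℝ (ρ • a) θ : ℝ)).tendsto 1).mono_left
      nhdsWithin_le_nhds
  rw [one_smul] at hlim
  refine le_of_tendsto hlim ?_
  filter_upwards [Ioo_mem_nhdsLT zero_lt_one] with ρ hρ
  obtain ⟨r, hr, c, hc, hball⟩ :=
    exists_ball_le_of_dualIntegral_ne_top hf he hone hpos hfin hJ hρ.1 hρ.2
  refine inner_le_of_dualIntegral_lt hlam hlam' hyp hf he hone hpos hfin hr hc hball ?_ hθ1 hα
  refine lt_of_lt_of_le ?_ ha
  exact (ENNReal.mul_lt_mul_iff_right hpos.ne' hfin.ne).2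
    (dualIntegral_smul_lt hf he hone hpos hfin ha0 hJ hρ.1 hρ.2)

lemma isLogConcave_const_mul {n : ℕ} {f : E n → ℝ≥0} (hf : IsLogConcave f) {c : ℝ≥0}
    (hc : 0 < c) : IsLogConcave fun x => c * f x := by
  intro x y hx hy t h0 h1
  have hx' : 0 < f x := pos_of_mul_pos_right hx hc.le
  have hy' : 0 < f y := pos_of_mul_pos_right hy hc.le
  calc (c * f x) ^ t * (c * f y) ^ (1 - t) = (c ^ t * c ^ (1 - t)) * (f x ^ t * f y ^ (1 - t)) := by
        rw [NNReal.mul_rpow, NNReal.mul_rpow]; ring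
    _ = c * (f x ^ t * f y ^ (1 - t)) := by rw [← NNReal.rpow_add hc.ne']; simp
    _ ≤ _ := mul_le_mul_right (hf x y hx' hy' t h0 h1) c

lemma dualFun_const_mul {n : ℕ} (f : E n → ℝ≥0) {c : ℝ≥0} (hc : 0 < c) (u : E n) :
    dualFun (fun x => c * f x) u = (c : ℝ≥0∞)⁻¹ * dualFun f u := by
  have hc' : (c : ℝ≥0∞) ≠ 0 := by simpa using hc.ne'
  unfold dualFun
  rw [ENNReal.mul_iInf_of_ne (ENNReal.inv_ne_zero.2 ENNReal.coe_ne_top) (ENNReal.inv_ne_top.2 hc')]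
  refine iInf_congr fun y => ?_
  rw [ENNReal.coe_mul, div_eq_mul_inv, div_eq_mul_inv,
    ENNReal.mul_inv (Or.inl hc') (Or.inl ENNReal.coe_ne_top)]
  ring

lemma santaloFun_const_mul {n : ℕ} (f : E n → ℝ≥0) {c : ℝ≥0} (hc : 0 < c) (d : ℝ) :
    santaloFun (fun x => c * f x) d = santaloFun f d := by
  have hc' : (c : ℝ≥0∞) ≠ 0 := by simpa using hc.ne'
  ext a
  have h1 : ∫⁻ x, (translate (fun x => c * f x) a x : ℝ≥0∞) =
      c * ∫⁻ x, (translate f a x : ℝ≥0∞) := by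
    simp only [translate, ENNReal.coe_mul]
    exact lintegral_const_mul' _ _ ENNReal.coe_ne_top
  have h2 : ∫⁻ u, dualFun (translate (fun x => c * f x) a) u =
      (c : ℝ≥0∞)⁻¹ * ∫⁻ u, dualFun (translate f a) u := by
    rw [← lintegral_const_mul' _ _ (ENNReal.inv_ne_top.2 hc')]
    exact lintegral_congr fun u => dualFun_const_mul (translate f a) hc u
  simp only [santaloFun, mem_ofPred_eq, h1, h2]
  rw [mul_mul_mul_comm, ENNReal.mul_inv_cancel hc' ENNReal.coe_ne_top, one_mul]

lemma floatingFun_const_mul {n : ℕ} (f : E n → ℝ≥0) {c : ℝ≥0} (hc : 0 < c) (lam : ℝ) :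
    floatingFun (fun x => c * f x) lam = floatingFun f lam := by
  have hc' : (c : ℝ≥0∞) ≠ 0 := by simpa using hc.ne'
  unfold floatingFun
  simp only [ENNReal.coe_mul, lintegral_const_mul' _ _ ENNReal.coe_ne_top,
    mul_left_comm (ENNReal.ofReal lam), ENNReal.mul_right_inj hc' ENNReal.coe_ne_top]

lemma functionInclusion_of_isRevolution {n : ℕ} {lam d : ℝ} (hlam : 0 < lam)
    (hlam' : lam < 1 / 2)
    (hyp : ∀ (s : ℕ) (K : Set (E (n + s))), 1 ≤ s → IsConvexBody K → IsCentrallySymmetric K →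
      IsRevolution K → santaloBody K d ⊆ floatingBody K lam) : FunctionInclusion n lam d := by
  intro f he hf hpos hfin
  have h0 : 0 < f 0 := by
    by_contra hcon
    have : ∀ x, f x = 0 := fun x =>
      le_antisymm ((hf.le_apply_zero he x).trans (not_lt.1 hcon)) zero_le
    simp [this] at hpos
  have hc : 0 < (f 0)⁻¹ := inv_pos.2 h0
  have hint : ∫⁻ x, (((f 0)⁻¹ * f x : ℝ≥0) : ℝ≥0∞) =
      ((f 0)⁻¹ : ℝ≥0) * ∫⁻ x, (f x : ℝ≥0∞) := by
    simp only [ENNReal.coe_mul]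
    exact lintegral_const_mul' _ _ ENNReal.coe_ne_top
  rw [← santaloFun_const_mul f hc, ← floatingFun_const_mul f hc]
  refine santaloFun_subset_floatingFun_of_apply_zero hlam hlam' hyp (isLogConcave_const_mul hf hc)
    (fun x => by rw [he x]) (inv_mul_cancel₀ h0.ne') ?_ ?_
  · rw [hint]
    exact ENNReal.mul_pos (by simpa using h0.ne') hpos.ne'
  · rw [hint]
    exact ENNReal.mul_lt_top ENNReal.coe_lt_top hfin

end SantaloFloating

theorem mainTheorem2 (lam d : ℝ) (hlam : 0 < lam) (hlam' : lam < 1 / 2) (hd : 0 < d) :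
    ((∀ (m : ℕ) (K : Set (SantaloFloating.E m)),
        SantaloFloating.IsConvexBody K → SantaloFloating.IsCentrallySymmetric K →
        SantaloFloating.santaloBody K d ⊆ SantaloFloating.floatingBody K lam) →
      ∀ n : ℕ, SantaloFloating.FunctionInclusion n lam d) ∧
    (∀ n : ℕ,
      (∀ (s : ℕ) (K : Set (SantaloFloating.E (n + s))), 1 ≤ s →
        SantaloFloating.IsConvexBody K → SantaloFloating.IsCentrallySymmetric K →
        SantaloFloating.IsRevolution K →
        SantaloFloating.santaloBody K d ⊆ SantaloFloating.floatingBody K lam) →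
      SantaloFloating.FunctionInclusion n lam d) :=
  ⟨fun h _ => SantaloFloating.functionInclusion_of_isRevolution hlam hlam'
      fun _ K _ hK hsym _ => h _ K hK hsym,
    fun _ h => SantaloFloating.functionInclusion_of_isRevolution hlam hlam' h⟩
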